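/- **Setting.** Let $(\mathcal M,\langle\cdot,\cdot\rangle)$ be a finite-dimensional complex Hermitian space (for instance an algebra of complex matrices with $\langle A,B\rangle=\mathrm{tr}(AB^*)$), with Euclidean product $(u,v)=\mathrm{Re}\langle u,v\rangle$. Let $(N,g)$ be a smooth connected finite-dimensional Riemannian manifold, with a Riemannian embedding $N\subset\mathcal M$ and a base point $x_0\in N$. Let $S^1=\mathbb R/\mathbb Z$, and let $H^{s}(S^1,\mathcal M)$ be the Hilbert space with norm $\|f\|_s^2=\sum_{n\in\mathbb Z}(1+|n|)^{2s}\|f_n\|^2$, where $f_n$ are the Fourier coefficients. Let $\langle a,b\rangle_{-1/2,1/2}=\sum_n\mathrm{Re}\langle a_n,b_n\rangle$ be the duality pairing $H^{-1/2}\times H^{1/2}\to\mathbb R$, and $u\mapsto\dot u$ the derivative $H^{1/2}\to H^{-1/2}$. Let $C_0^\infty(S^1,N)$ be the space of smooth loops $\gamma$ in $N$ with $\gamma(0)=x_0$; its plots are the families $P$ of loops such that $(x,s)\mapsto P(x)(s)$ is smooth. Tangent vectors at $\gamma$ are the smooth vector fields $X$ along $\gamma$ with $X(0)=0$. Let $H^{1/2}_0(S^1,N)$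 be the closure of $C^\infty_0(S^1,N)$ in $H^{1/2}(S^1,\mathcal M)$, with the reflexive (Frölicher) completion of the diffeology induced by $H^{1/2}(S^1,\mathcal M)$. A $k$-form on a diffeological space assigns to each plot $p$ a smooth $k$-form $\alpha_p$ on its domain, such that $\alpha_p(Y_1,\dots,Y_k)=\alpha_q(Z_1,\dots,Z_k)$ whenever $p_*Y_i=q_*Z_i$ for all $i$. The exterior derivative of $1$-forms is normalized by $d\theta(X,Y)=\frac12\big(X\theta(Y)-Y\theta(X)-\theta([X,Y])\big)$. On $C_0^\infty(S^1,N)$ put $$\theta_\gamma(X)=\int_{S^1}(\dot\gamma(s),X(s))\,ds,\qquad \omega_N(X,Y)=\int_{S^1}\Big(\frac{\nabla^N}{ds}X(s),Y(s)\Big)ds,$$ where $\nabla^N$ is the Levi-Civita connection of $g$. **Theorem.** The inclusion $C_0^\infty(S^1,N)\to H^{1/2}_0(S^1,N)$ is smooth, and there are a $1$-form $\tilde\theta$ and a $2$-form $\tilde\omega$ on the diffeological (Frölicher) space $H^{1/2}_0(S^1,N)$ such that 1. $\tilde\theta_u(X)=\langle\dot u,X\rangle_{-1/2,1/2}$ and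 $\tilde\omega_u(X,Y)=\langle\dot X,Y\rangle_{-1/2,1/2}$ on every plot, that is, whenever $u=p(x)$, $X=Dp(x)v$, $Y=Dp(x)w$ for a plot $p$; 2. $\tilde\omega=d\tilde\theta$; 3. $\tilde\theta$ and $\tilde\omega$ restrict to $\theta$ and $\omega_N$ on $C_0^\infty(S^1,N)$; so $\omega_N=d\theta$ is an exact $2$-form there. Moreover $\omega_N$ is symplectic on $C_0^\infty(S^1,N)$ in the weak sense: it is skew-symmetric, and a tangent vector $X$ at $\gamma$ with $\omega_N(X,Y)=0$ for all tangent vectors $Y$ at $\gamma$ is zero. -/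

import Mathlib

open scoped ContDiff Manifold Topology

noncomputable section

namespace HalfLoop

/-! ### Sobolev spaces of loops -/

section Sobolev

variable (s : ℝ) (V : Type*) [NormedAddCommGroup V]

/-- The Sobolev space `H^s(S¹, V)`, `S¹ = ℝ/ℤ`. An element with Fourier coefficients `(a n)` is stored
as the square-summable sequence `n ↦ (1 + |n|)^s • a n`, so that the norm is
`(∑ (1 + |n|)^(2s) ‖a n‖²)^(1/2)`; see `coeff` and `hasSum_norm_sq`. -/
def Sobolev (_s : ℝ) (V : Type*) [NormedAddCommGroup V] : Type _ := lp (fun _ : ℤ => V) 2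

instance : NormedAddCommGroup (Sobolev s V) :=
  inferInstanceAs (NormedAddCommGroup (lp (fun _ : ℤ => V) 2))

instance [InnerProductSpace ℂ V] : InnerProductSpace ℂ (Sobolev s V) :=
  inferInstanceAs (InnerProductSpace ℂ (lp (fun _ : ℤ => V) 2))

instance [CompleteSpace V] : CompleteSpace (Sobolev s V) :=
  inferInstanceAs (CompleteSpace (lp (fun _ : ℤ => V) 2))

/-- The Fourier weight `1 + |n|`. -/
def weight (n : ℤ) : ℝ := 1 + |(n : ℝ)|

lemma weight_pos (n : ℤ) : 0 < weight n := by unfold weight; positivity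

variable {s V}

/-- The stored sequence `n ↦ (1 + |n|)^s • a n` of an element of `H^s`. -/
def Sobolev.seq (u : Sobolev s V) : lp (fun _ : ℤ => V) 2 := u

/-- The element of `H^s` with a given stored sequence. -/
def Sobolev.ofSeq (u : lp (fun _ : ℤ => V) 2) : Sobolev s V := u

variable [InnerProductSpace ℂ V]

/-- The `n`-th Fourier coefficient of an element of `H^s(S¹, V)`. -/
def Sobolev.coeff (u : Sobolev s V) (n : ℤ) : V := (weight n ^ (-s)) • (u.seq n : V)

lemma Sobolev.hasSum_norm_sq (u : Sobolev s V) :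
    HasSum (fun n : ℤ => weight n ^ (2 * s) * ‖u.coeff n‖ ^ 2) (‖u‖ ^ 2) := by
  have h := lp.hasSum_norm (p := 2) (by norm_num) u.seq
  change HasSum _ (‖u‖ ^ _) at h
  simp only [ENNReal.toReal_ofNat, Real.rpow_ofNat] at h
  convert h using 2 with n
  rw [Sobolev.coeff, norm_smul, mul_pow, ← mul_assoc, Real.norm_of_nonneg
    (Real.rpow_nonneg (weight_pos n).le _), ← Real.rpow_natCast (weight n ^ (-s)) 2,
    ← Real.rpow_mul (weight_pos n).le, ← Real.rpow_add (weight_pos n)]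
  norm_num
  ring_nf
  simp

/-- The duality pairing `H^{-s}(S¹, V) × H^s(S¹, V) → ℝ`, which extends `(a, b) ↦ ∫ (a(s), b(s)) ds`;
it is `∑ₙ Re ⟨a n, b n⟩` in Fourier coefficients, see `hasSum_pairing`. -/
def pairing (a : Sobolev (-s) V) (b : Sobolev s V) : ℝ := (inner ℂ a.seq b.seq).re

lemma hasSum_pairing (a : Sobolev (-s) V) (b : Sobolev s V) :
    HasSum (fun n : ℤ => (inner ℂ (a.coeff n) (b.coeff n)).re) (pairing a b) := by
  have h := Complex.hasSum_re (lp.hasSum_inner (𝕜 := ℂ) a.seq b.seq)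
  change HasSum _ (pairing a b) at h
  convert h using 2 with n
  rw [Sobolev.coeff, Sobolev.coeff, ← Complex.coe_smul, ← Complex.coe_smul, inner_smul_left,
    inner_smul_right, Complex.conj_ofReal, ← mul_assoc, ← Complex.ofReal_mul,
    ← Real.rpow_add (weight_pos n)]
  simp

/-- The derivative `d/ds : H^{1/2}(S¹, V) → H^{-1/2}(S¹, V)`: it multiplies the `n`-th Fourier
coefficient by `2πin`, see `coeff_derivHalf`. -/
def derivHalf (u : Sobolev (1 / 2) V) : Sobolev (-(1 / 2)) V :=
  Sobolev.ofSeq ⟨fun n : ℤ => (((weight n)⁻¹ : ℝ) * (2 * Real.pi * Complex.I * n) : ℂ) • (u.seq n : V), by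
    refine Memℓp.mono' (Memℓp.const_smul (lp.memℓp u.seq) (2 * Real.pi : ℝ)) fun n => ?_
    have hw := weight_pos n
    have h1 : |(n : ℝ)| ≤ weight n := by unfold weight; linarith
    rw [Pi.smul_apply, norm_smul, norm_smul]
    gcongr
    simp only [norm_mul, Complex.norm_real, Complex.norm_I, Complex.norm_intCast, norm_inv,
      Complex.norm_ofNat, Real.norm_eq_abs, abs_of_pos hw, abs_of_pos Real.pi_pos, abs_two]
    rw [inv_mul_le_iff₀ hw]
    nlinarith [Real.pi_pos]⟩

lemma coeff_derivHalf (u : Sobolev (1 / 2) V) (n : ℤ) :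
    (derivHalf u).coeff n = (2 * Real.pi * Complex.I * n : ℂ) • u.coeff n := by
  have hw := weight_pos n
  have h : (derivHalf u).seq n
      = (((weight n)⁻¹ : ℝ) * (2 * Real.pi * Complex.I * n) : ℂ) • (u.seq n : V) := rfl
  rw [Sobolev.coeff, Sobolev.coeff, h, mul_smul, Complex.coe_smul, smul_smul, smul_comm]
  congr 2
  rw [← Real.rpow_neg_one, ← Real.rpow_add hw]
  norm_num

/-- The Fourier coefficients `∫₀¹ exp(-2πins) f(s) ds` of a `1`-periodic function `f`. -/
def loopCoeff (f : ℝ → V) (n : ℤ) : V := fourierCoeffOn (zero_lt_one' ℝ) f n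

lemma loopCoeff_eq (f : ℝ → V) (n : ℤ) :
    loopCoeff f n = ∫ t in (0 : ℝ)..1, Complex.exp (-(2 * Real.pi * Complex.I * n) * t) • f t := by
  rw [loopCoeff, fourierCoeffOn_eq_integral]
  simp only [sub_zero, div_one, one_smul]
  refine intervalIntegral.integral_congr fun t _ => ?_
  simp only [fourier_coe_apply]
  congr 2
  push_cast
  ring

lemma loopCoeff_decay [CompleteSpace V] {f : ℝ → V} (hf : ContDiff ℝ 2 f)
    (hp : Function.Periodic f 1) : ∃ C : ℝ, ∀ n : ℤ, weight n ^ 2 * ‖loopCoeff f n‖ ≤ C := by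
  have hcont : Continuous f := hf.continuous
  have hf1 : ContDiff ℝ 1 (deriv f) := by
    have := (contDiff_succ_iff_deriv (𝕜 := ℝ) (n := 1) (f := f)).1 (by simpa [one_add_one_eq_two] using hf)
    exact this.2.2
  have hc1 : Continuous (deriv f) := hf1.continuous
  have hc2 : Continuous (deriv (deriv f)) := hf1.continuous_deriv le_rfl
  have hd0 : ∀ t, HasDerivAt f (deriv f t) t := fun t =>
    (hf.differentiable (by norm_num) t).hasDerivAt
  have hd1 : ∀ t, HasDerivAt (deriv f) (deriv (deriv f) t) t := fun t =>
    (hf1.differentiable (by norm_num) t).hasDerivAt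
  have hp1 : deriv f 1 = deriv f 0 := by
    have h : (fun t => f (t + 1)) = f := funext hp
    have h2 := deriv_comp_add_const f 1 (0 : ℝ)
    rw [h] at h2
    simpa using h2.symm
  have hp0 : f 1 = f 0 := by simpa using hp 0
  have bound : ∀ h : ℝ → V, Continuous h → ∃ C : ℝ, ∀ n : ℤ, ‖loopCoeff h n‖ ≤ C := by
    intro h hh
    obtain ⟨C, hC⟩ := (isCompact_Icc (a := (0 : ℝ)) (b := 1)).exists_bound_of_continuousOn
      hh.continuousOn
    refine ⟨C, fun n => ?_⟩
    rw [loopCoeff_eq]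
    have := intervalIntegral.norm_integral_le_of_norm_le_const (a := (0 : ℝ)) (b := 1) (C := C)
      (f := fun t : ℝ => Complex.exp (-(2 * Real.pi * Complex.I * n) * t) • h t) ?_
    · simpa using this
    · intro t ht
      rw [Set.uIoc_of_le zero_le_one] at ht
      have e : ‖Complex.exp (-(2 * Real.pi * Complex.I * n) * t)‖ = 1 := by
        rw [Complex.norm_exp]; simp
      rw [norm_smul, e, one_mul]
      exact hC t ⟨ht.1.le, ht.2⟩
  obtain ⟨C0, hC0⟩ := bound f hcont
  obtain ⟨C2, hC2⟩ := bound _ hc2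
  have key : ∀ n : ℤ, loopCoeff (deriv (deriv f)) n
      = ((2 * Real.pi * Complex.I * n : ℂ) ^ 2) • loopCoeff f n := by
    intro n
    set k : ℂ := 2 * Real.pi * Complex.I * n with hk
    have he : ∀ t : ℝ, HasDerivAt (fun t : ℝ => Complex.exp (-k * t))
        (Complex.exp (-k * t) * (-k)) t := by
      intro t
      have h1 : HasDerivAt (fun z : ℂ => Complex.exp (-k * z)) (Complex.exp (-k * t) * (-k)) t := by
        have := (hasDerivAt_id (t : ℂ)).const_mul (-k)
        simpa using this.cexp
      exact h1.comp_ofReal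
    have hF : ∀ t : ℝ, HasDerivAt (fun t : ℝ => Complex.exp (-k * t) • (deriv f t + k • f t))
        (Complex.exp (-k * t) • deriv (deriv f) t - k ^ 2 • (Complex.exp (-k * t) • f t)) t := by
      intro t
      have h := (he t).smul ((hd1 t).add ((hd0 t).const_smul k))
      have e : Complex.exp (-k * t) • deriv (deriv f) t - k ^ 2 • (Complex.exp (-k * t) • f t)
          = Complex.exp (-k * t) • (deriv (deriv f) t + k • deriv f t)
            + (Complex.exp (-k * t) * (-k)) • (deriv f t + k • f t) := by module
      rw [e]
      exact h
    have hce : Continuous fun t : ℝ => Complex.exp (-k * t) := by fun_prop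
    have i1 : IntervalIntegrable (fun t : ℝ => Complex.exp (-k * t) • deriv (deriv f) t)
      MeasureTheory.volume 0 1 := (hce.smul hc2).intervalIntegrable _ _
    have i2 : IntervalIntegrable (fun t : ℝ => k ^ 2 • (Complex.exp (-k * t) • f t))
      MeasureTheory.volume 0 1 := ((hce.smul hcont).const_smul _).intervalIntegrable _ _
    have hI := intervalIntegral.integral_eq_sub_of_hasDerivAt (fun t _ => hF t) (i1.sub i2)
    have e1 : Complex.exp (-k * (1 : ℝ)) = 1 := by
      rw [Complex.exp_eq_one_iff]
      exact ⟨-n, by rw [hk]; push_cast; ring⟩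
    rw [e1, hp0, hp1, intervalIntegral.integral_sub i1 i2, intervalIntegral.integral_smul] at hI
    simp only [Complex.ofReal_zero, mul_zero, Complex.exp_zero, sub_self] at hI
    rw [loopCoeff_eq, loopCoeff_eq]
    exact sub_eq_zero.1 hI
  refine ⟨2 * C0 + 2 * C2, fun n => ?_⟩
  have h2 : (n : ℝ) ^ 2 * ‖loopCoeff f n‖ ≤ C2 := by
    have := hC2 n
    rw [key n, norm_smul] at this
    simp only [norm_pow, norm_mul, Complex.norm_ofNat, Complex.norm_real, Complex.norm_I,
      Complex.norm_intCast, Real.norm_eq_abs, abs_of_pos Real.pi_pos, mul_pow,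
      sq_abs] at this
    have hpi : 1 ≤ 2 ^ 2 * Real.pi ^ 2 := by nlinarith [Real.pi_gt_three]
    have hnn : 0 ≤ (n : ℝ) ^ 2 * ‖loopCoeff f n‖ := by positivity
    nlinarith
  have hw : weight n ^ 2 ≤ 2 + 2 * (n : ℝ) ^ 2 := by
    unfold weight
    nlinarith [sq_nonneg (1 - |(n : ℝ)|), sq_abs (n : ℝ)]
  calc weight n ^ 2 * ‖loopCoeff f n‖ ≤ (2 + 2 * (n : ℝ) ^ 2) * ‖loopCoeff f n‖ := by gcongr
    _ ≤ 2 * C0 + 2 * C2 := by nlinarith [hC0 n]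

lemma memℓp_loopCoeff [CompleteSpace V] {f : ℝ → V} (hf : ContDiff ℝ 2 f)
    (hp : Function.Periodic f 1) :
    Memℓp (fun n : ℤ => (weight n ^ (1 / 2 : ℝ)) • loopCoeff f n) 2 := by
  obtain ⟨C, hC⟩ := loopCoeff_decay hf hp
  refine memℓp_gen ?_
  simp only [ENNReal.toReal_ofNat, Real.rpow_ofNat]
  have hs : Summable fun n : ℤ => C ^ 2 * (1 / (n : ℝ) ^ 2) :=
    (Real.summable_one_div_int_pow.2 (by norm_num)).mul_left _
  refine hs.of_norm_bounded_eventually ?_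
  filter_upwards [(Set.finite_singleton (0 : ℤ)).compl_mem_cofinite] with n hn
  have hn0 : n ≠ 0 := by simpa using hn
  have hw := weight_pos n
  have hw1 : |(n : ℝ)| ≤ weight n := by unfold weight; linarith
  have hn1 : (1 : ℝ) ≤ (n : ℝ) ^ 2 := by
    have : 0 < n ^ 2 := by positivity
    exact_mod_cast this
  have hC0 := hC n
  have hww : (n : ℝ) ^ 2 ≤ weight n ^ 2 := by
    rw [← sq_abs (n : ℝ)]; gcongr
  rw [norm_smul, mul_pow, Real.norm_of_nonneg (Real.rpow_nonneg hw.le _),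
    ← Real.rpow_natCast (weight n ^ (1 / 2 : ℝ)) 2, ← Real.rpow_mul hw.le]
  norm_num
  set x := ‖loopCoeff f n‖ with hx
  have hx0 : 0 ≤ x := norm_nonneg _
  have hw2 : 1 ≤ weight n := by unfold weight; linarith [abs_nonneg (n : ℝ)]
  rw [abs_of_pos hw, ← div_eq_mul_inv, le_div_iff₀ (by positivity)]
  have h3 : (weight n ^ 2 * x) ^ 2 ≤ C ^ 2 := by gcongr
  calc weight n * x ^ 2 * (n : ℝ) ^ 2 ≤ weight n * x ^ 2 * weight n ^ 2 := by gcongr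
    _ = weight n ^ 3 * x ^ 2 := by ring
    _ ≤ weight n ^ 4 * x ^ 2 := by gcongr; norm_num
    _ = (weight n ^ 2 * x) ^ 2 := by ring
    _ ≤ C ^ 2 := h3

/-- A smooth `1`-periodic function, seen as an element of `H^{1/2}(S¹, V)`. -/
def ofSmoothLoop [FiniteDimensional ℂ V] (f : ℝ → V) (hf : ContDiff ℝ ∞ f)
    (hp : Function.Periodic f 1) : Sobolev (1 / 2) V :=
  Sobolev.ofSeq ⟨fun n : ℤ => (weight n ^ (1 / 2 : ℝ)) • loopCoeff f n,
    haveI := FiniteDimensional.complete ℂ V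
    memℓp_loopCoeff (contDiff_infty.1 hf 2) hp⟩

lemma coeff_ofSmoothLoop [FiniteDimensional ℂ V] (f : ℝ → V) (hf : ContDiff ℝ ∞ f)
    (hp : Function.Periodic f 1) (n : ℤ) : (ofSmoothLoop f hf hp).coeff n = loopCoeff f n := by
  have h : (ofSmoothLoop f hf hp).seq n = (weight n ^ (1 / 2 : ℝ)) • loopCoeff f n := rfl
  rw [Sobolev.coeff, h, smul_smul, ← Real.rpow_add (weight_pos n)]
  simp

end Sobolev

/-! ### Diffeologies and differential forms -/

section Diffeology

variable {X : Type*}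

/-- The diffeology defined by a set `F` of real functions: a parametrization `p` is a plot if and only
if `f ∘ p` is smooth for all `f ∈ F`. -/
@[reducible]
def diffeologyOfFunctions (F : Set (X → ℝ)) : DiffeologicalSpace X :=
  .ofCorePlotsOn {
    isPlotOn := fun {_ u} _ p => ∀ f ∈ F, ContDiffOn ℝ ∞ (f ∘ p) u
    isPlotOn_congr := fun {_ u} _ p q h => forall₂_congr fun f _ =>
      contDiffOn_congr fun x hx => congrArg f (h hx)
    isPlot_const := fun _ _ _ => contDiffOn_const
    isPlotOn_reparam := fun _ _ _ h hp hf f hfF => (hp f hfF).comp hf h.subset_preimage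
    locality := fun _ _ h f hfF x hx => by
      obtain ⟨v, hv, hxv, hv'⟩ := h x hx
      exact ((hv' f hfF x hxv).contDiffAt (hv.mem_nhds hxv)).contDiffWithinAt }

/-- The trace (subset) diffeology on `A`: the plots of `X` with image contained in `A`. -/
@[reducible]
def traceDiffeology (d : DiffeologicalSpace X) (A : Set X) : DiffeologicalSpace A where
  plots n := {p | (fun x => (p x : X)) ∈ d.plots n}
  constant_plots x := d.constant_plots (x : X)
  plot_reparam hp hf := d.plot_reparam hp hf
  locality hp := d.locality hp

/-- The reflexive (Frölicher) completion of a diffeology: its plots are the parametrizations `p` such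
that `f ∘ p` is smooth for every real function `f` which is smooth for the given diffeology. -/
@[reducible]
def reflexiveCompletion (d : DiffeologicalSpace X) : DiffeologicalSpace X :=
  diffeologyOfFunctions {f : X → ℝ | @Diffeology.DSmooth X ℝ d _ f}

/-- The diffeology of the natural Frölicher structure of a normed space `H`, given by the smooth
functions `H → ℝ`. -/
@[reducible]
def normedDiffeology (H : Type*) [NormedAddCommGroup H] [NormedSpace ℝ H] : DiffeologicalSpace H :=
  diffeologyOfFunctions {f : H → ℝ | ContDiff ℝ ∞ f}

/-- Equality of the push-forwards `p_* Y` and `q_* Z`, as tangent vectors of `X`: same base point, and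
same derivative on every smooth function `X → ℝ`. -/
def SameTangent [DiffeologicalSpace X] {n m : ℕ} (p : EuclideanSpace ℝ (Fin n) → X)
    (q : EuclideanSpace ℝ (Fin m) → X) (y Y : EuclideanSpace ℝ (Fin n))
    (z Z : EuclideanSpace ℝ (Fin m)) : Prop :=
  p y = q z ∧ ∀ f : X → ℝ, Diffeology.DSmooth f → fderiv ℝ (f ∘ p) y Y = fderiv ℝ (f ∘ q) z Z

/-- A differential `k`-form on a diffeological space: a smooth `k`-form `α p` on the domain of each plot
`p`, such that `α p (Y₁, …, Y_k) = α q (Z₁, …, Z_k)` whenever `p_* Yᵢ = q_* Zᵢ` for all `i`. In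
particular `α (p ∘ h) = h^* (α p)` for smooth `h`, see `DForm.pullback_plot`. -/
structure DForm (k : ℕ) (X : Type*) [DiffeologicalSpace X] where
  onPlot : ∀ {n : ℕ} (p : EuclideanSpace ℝ (Fin n) → X), Diffeology.IsPlot p →
    EuclideanSpace ℝ (Fin n) → EuclideanSpace ℝ (Fin n) [⋀^Fin k]→L[ℝ] ℝ
  smooth : ∀ {n : ℕ} (p : EuclideanSpace ℝ (Fin n) → X) (hp : Diffeology.IsPlot p),
    ContDiff ℝ ∞ (onPlot p hp)
  compat : ∀ {n m : ℕ} (p : EuclideanSpace ℝ (Fin n) → X) (q : EuclideanSpace ℝ (Fin m) → X)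
    (hp : Diffeology.IsPlot p) (hq : Diffeology.IsPlot q) (y : EuclideanSpace ℝ (Fin n))
    (z : EuclideanSpace ℝ (Fin m)) (Y : Fin k → EuclideanSpace ℝ (Fin n))
    (Z : Fin k → EuclideanSpace ℝ (Fin m)),
    (∀ i, SameTangent p q y (Y i) z (Z i)) → p y = q z → onPlot p hp y Y = onPlot q hq z Z

lemma DForm.pullback_plot [DiffeologicalSpace X] {k n m : ℕ} (α : DForm k X)
    (p : EuclideanSpace ℝ (Fin n) → X) (hp : Diffeology.IsPlot p)
    (h : EuclideanSpace ℝ (Fin m) → EuclideanSpace ℝ (Fin n)) (hh : ContDiff ℝ ∞ h)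
    (z : EuclideanSpace ℝ (Fin m)) :
    α.onPlot (p ∘ h) (Diffeology.isPlot_reparam hp hh) z
      = (α.onPlot p hp (h z)).compContinuousLinearMap (fderiv ℝ h z) := by
  ext Z
  refine α.compat _ _ _ _ _ _ _ _ (fun i => ⟨rfl, fun f hf => ?_⟩) rfl
  have h1 : ContDiff ℝ ∞ (f ∘ p) := Diffeology.isPlot_iff_contDiff.1 (hf _ _ hp)
  rw [← Function.comp_assoc, fderiv_comp z (h1.differentiable (by simp) _)
    (hh.differentiable (by simp) _)]
  rfl

/-- The pull-back (restriction, when `j` is an inclusion) of a form by a smooth map. -/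
def DForm.pullback {Y : Type*} [DiffeologicalSpace X] [DiffeologicalSpace Y] {k : ℕ}
    (α : DForm k Y) (j : X → Y) (hj : Diffeology.DSmooth j) : DForm k X where
  onPlot p hp := α.onPlot (j ∘ p) (hj _ p hp)
  smooth _ _ := α.smooth _ _
  compat _ _ _ _ _ _ _ _ h h0 := α.compat _ _ _ _ _ _ _ _
    (fun i => ⟨congrArg j h0, fun f hf => (h i).2 (f ∘ j) (hf.comp hj)⟩) (congrArg j h0)

/-- `β = dα`, for a `1`-form `α`, with the normalization
`dα(X, Y) = ½ (X α(Y) - Y α(X) - α([X, Y]))` of the exterior derivative. -/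
def DForm.IsHalfD [DiffeologicalSpace X] (α : DForm 1 X) (β : DForm 2 X) : Prop :=
  ∀ {n : ℕ} (p : EuclideanSpace ℝ (Fin n) → X) (hp : Diffeology.IsPlot p)
    (x : EuclideanSpace ℝ (Fin n)),
    β.onPlot p hp x = (1 / 2 : ℝ) • extDeriv (α.onPlot p hp) x

end Diffeology

/-! ### Loops in a Riemannian manifold -/

section Loops

variable {E : Type*} [NormedAddCommGroup E] [NormedSpace ℝ E]
  {N : Type*} [TopologicalSpace N] [ChartedSpace E N]

/-- A smooth loop `S¹ = ℝ/ℤ → N` based at `x₀`, as a smooth `1`-periodic map `ℝ → N`. -/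
structure BasedLoop (E : Type*) [NormedAddCommGroup E] [NormedSpace ℝ E] {N : Type*}
    [TopologicalSpace N] [ChartedSpace E N] (x₀ : N) where
  toFun : ℝ → N
  smooth : ContMDiff 𝓘(ℝ, ℝ) 𝓘(ℝ, E) ∞ toFun
  periodic : Function.Periodic toFun 1
  base : toFun 0 = x₀

/-- The functional diffeology of the based loop space `C^∞_0(S¹, N)`: the plots are the families of
loops `P` such that `(x, s) ↦ P x s` is smooth. -/
instance (x₀ : N) : DiffeologicalSpace (BasedLoop E x₀) :=
  .ofCorePlotsOn {
    isPlotOn := fun {n u} _ P => ContMDiffOn (𝓘(ℝ, EuclideanSpace ℝ (Fin n)).prod 𝓘(ℝ, ℝ)) 𝓘(ℝ, E) ∞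
      (fun z : EuclideanSpace ℝ (Fin n) × ℝ => (P z.1).toFun z.2) (u ×ˢ Set.univ)
    isPlotOn_congr := fun {n u} _ P Q h => contMDiffOn_congr fun z hz => by
      have : P z.1 = Q z.1 := h hz.1
      simp only [this]
    isPlot_const := fun {n} γ =>
      (γ.smooth.comp (contMDiff_snd (I := 𝓘(ℝ, EuclideanSpace ℝ (Fin n))))).contMDiffOn
    isPlotOn_reparam := fun {n m u v hu} hv {p f} h hp hf =>
      hp.comp (t := u ×ˢ Set.univ)
        (f := fun z : EuclideanSpace ℝ (Fin m) × ℝ => (f z.1, z.2))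
        ((hf.contMDiffOn.comp contMDiffOn_fst fun z hz => hz.1).prodMk contMDiffOn_snd)
        (fun z hz => ⟨h hz.1, trivial⟩)
    locality := fun {n u} hu {p} h z hz => by
      obtain ⟨v, hv, hxv, hv'⟩ := h z.1 hz.1
      exact ((hv' z ⟨hxv, trivial⟩).contMDiffAt
        ((hv.prod isOpen_univ).mem_nhds ⟨hxv, trivial⟩)).contMDiffWithinAt }

/-- A tangent vector of `C^∞_0(S¹, N)` at `γ`: a smooth loop of tangent vectors `X s ∈ T_{γ(s)} N` with
`X 0 = 0`. -/
structure BasedLoop.Tangent {x₀ : N} [IsManifold 𝓘(ℝ, E) ∞ N] (γ : BasedLoop E x₀) where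
  toFun : ∀ s : ℝ, TangentSpace 𝓘(ℝ, E) (γ.toFun s)
  smooth : ContMDiff 𝓘(ℝ, ℝ) 𝓘(ℝ, E).tangent ∞
    (fun s => (⟨γ.toFun s, toFun s⟩ : TangentBundle 𝓘(ℝ, E) N))
  periodic : Function.Periodic (fun s => (⟨γ.toFun s, toFun s⟩ : TangentBundle 𝓘(ℝ, E) N)) 1
  base : toFun 0 = 0

section LeviCivita

variable [IsManifold 𝓘(ℝ, E) ∞ N] (g : Bundle.ContMDiffRiemannianMetric 𝓘(ℝ, E) ∞ E
    (fun x : N => TangentSpace 𝓘(ℝ, E) x))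

/-- The metric `g`, read in the preferred chart at `q`. -/
def chartMetric (q : N) (y a b : E) : ℝ :=
  g.inner ((extChartAt 𝓘(ℝ, E) q).symm y)
    (mfderiv 𝓘(ℝ, E) 𝓘(ℝ, E) (extChartAt 𝓘(ℝ, E) q).symm y a)
    (mfderiv 𝓘(ℝ, E) 𝓘(ℝ, E) (extChartAt 𝓘(ℝ, E) q).symm y b)

/-- The Christoffel symbols of the first kind
`½ (∂_a g(b, c) + ∂_b g(a, c) - ∂_c g(a, b))` in the preferred chart at `q`. -/
def christoffelLower (q : N) (y a b c : E) : ℝ :=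
  (1 / 2) * (fderiv ℝ (fun z => chartMetric g q z b c) y a
    + fderiv ℝ (fun z => chartMetric g q z a c) y b
    - fderiv ℝ (fun z => chartMetric g q z a b) y c)

/-- The Christoffel symbols of the second kind: `Γ(a, b)` is the vector (unique, since `g` is positive
definite) such that `g(Γ(a, b), c)` is the symbol of the first kind, for all `c`. -/
def christoffel (q : N) (y a b : E) : E :=
  Classical.epsilon fun w => ∀ c, chartMetric g q y w c = christoffelLower g q y a b c

/-- The covariant derivative `∇X/ds` for the Levi-Civita connection of `g`, of a vector field `X` along
a curve `γ`: in the chart at `γ s`, it is `dX/ds + Γ(dγ/ds, X)`. -/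
def covDeriv (γ : ℝ → N) (X : ∀ t : ℝ, TangentSpace 𝓘(ℝ, E) (γ t)) (s : ℝ) :
    TangentSpace 𝓘(ℝ, E) (γ s) :=
  let φ := extChartAt 𝓘(ℝ, E) (γ s)
  let c : ℝ → E := fun t => φ (γ t)
  let W : ℝ → E := fun t => mfderiv 𝓘(ℝ, E) 𝓘(ℝ, E) φ (γ t) (X t)
  (mfderiv 𝓘(ℝ, E) 𝓘(ℝ, E) φ (γ s)).inverse
    (deriv W s + christoffel g (γ s) (c s) (deriv c s) (W s))

/-- The form `ω_N(X, Y) = ∫_{S¹} (∇X/ds, Y) ds` of vector fields along a loop. -/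
def omegaN (γ : ℝ → N) (X Y : ∀ t : ℝ, TangentSpace 𝓘(ℝ, E) (γ t)) : ℝ :=
  ∫ s in (0 : ℝ)..1, g.inner (γ s) (covDeriv g γ X s) (Y s)

variable {V : Type*} [NormedAddCommGroup V] [InnerProductSpace ℂ V]

/-- A Riemannian embedding of `(N, g)` into `V`, equipped with the Euclidean product `Re ⟨u, v⟩`. -/
structure IsRiemannianEmbedding (ι : N → V) : Prop where
  isSmoothEmbedding : Manifold.IsSmoothEmbedding 𝓘(ℝ, E) 𝓘(ℝ, V) ∞ ι
  isometric : ∀ (x : N) (u v : TangentSpace 𝓘(ℝ, E) x),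
    (@inner ℂ V _ (mfderiv 𝓘(ℝ, E) 𝓘(ℝ, V) ι x u) (mfderiv 𝓘(ℝ, E) 𝓘(ℝ, V) ι x v)).re
      = g.inner x u v

end LeviCivita

variable {V : Type*} [NormedAddCommGroup V] [InnerProductSpace ℂ V] [FiniteDimensional ℂ V]

/-- The canonical `1`-form `θ(X) = ∫_{S¹} (γ', X) ds`, of a loop `γ` in `N ⊆ V` and a vector field `X`
along `γ`. -/
def thetaN (ι : N → V) (γ : ℝ → N) (X : ∀ t : ℝ, TangentSpace 𝓘(ℝ, E) (γ t)) : ℝ :=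
  ∫ s in (0 : ℝ)..1,
    (@inner ℂ V _ (deriv (fun t => ι (γ t)) s) (mfderiv 𝓘(ℝ, E) 𝓘(ℝ, V) ι (γ s) (X s))).re

/-- A smooth based loop in `N ⊆ V`, as an element of `H^{1/2}(S¹, V)`. -/
def BasedLoop.toSobolev {x₀ : N} (ι : N → V) (hι : ContMDiff 𝓘(ℝ, E) 𝓘(ℝ, V) ∞ ι)
    (γ : BasedLoop E x₀) : Sobolev (1 / 2) V :=
  ofSmoothLoop (ι ∘ γ.toFun) (contMDiff_iff_contDiff.1 (hι.comp γ.smooth))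
    (γ.periodic.comp ι)

/-- The space `H^{1/2}_0(S¹, N)`: the closure of `C^∞_0(S¹, N)` in `H^{1/2}(S¹, V)`. -/
def HalfLoopSpace (ι : N → V) (hι : ContMDiff 𝓘(ℝ, E) 𝓘(ℝ, V) ∞ ι) (x₀ : N) :
    Set (Sobolev (1 / 2) V) :=
  closure (Set.range (BasedLoop.toSobolev (x₀ := x₀) ι hι))

/-- `H^{1/2}_0(S¹, N)` carries the reflexive completion of the trace of the natural diffeology of the
Hilbert space `H^{1/2}(S¹, V)`. -/
instance (ι : N → V) (hι : ContMDiff 𝓘(ℝ, E) 𝓘(ℝ, V) ∞ ι) (x₀ : N) :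
    DiffeologicalSpace (HalfLoopSpace ι hι x₀) :=
  reflexiveCompletion (traceDiffeology (normedDiffeology (Sobolev (1 / 2) V)) (HalfLoopSpace ι hι x₀))

/-- The inclusion `C^∞_0(S¹, N) → H^{1/2}_0(S¹, N)`. -/
def BasedLoop.incl {x₀ : N} (ι : N → V) (hι : ContMDiff 𝓘(ℝ, E) 𝓘(ℝ, V) ∞ ι) (γ : BasedLoop E x₀) :
    HalfLoopSpace ι hι x₀ :=
  ⟨γ.toSobolev ι hι, subset_closure ⟨γ, rfl⟩⟩

/-- The velocity `∂_v P` of a family of loops `P` at the parameter `x`, a vector field along `P x`. -/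
def velocity {x₀ : N} {n : ℕ} (P : EuclideanSpace ℝ (Fin n) → BasedLoop E x₀)
    (x v : EuclideanSpace ℝ (Fin n)) (s : ℝ) : TangentSpace 𝓘(ℝ, E) ((P x).toFun s) :=
  mfderiv 𝓘(ℝ, EuclideanSpace ℝ (Fin n)) 𝓘(ℝ, E) (fun y => (P y).toFun s) x v

end Loops

end HalfLoop

end

open HalfLoop

/-! On `H^{1/2}` the pairing `B(u, v) = ⟨u', v⟩` is a bounded bilinear form: a derivative costs one
power of `1 + |n|`, and the two half powers pay for it (`derivPairing`). It is skew because the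
symbol `2πin` is imaginary (`derivPairing_skew`). For a smooth map `u` into the Hilbert space, the
exterior derivative of `v ↦ B(u, ∂_v u)` loses its second-order terms by symmetry of second
derivatives, and skewness makes the rest `2 B(∂_v u, ∂_w u)`; the normalization ½ leaves `B`
(`extDeriv_bilinForm_apply`).

The geometry of the closure `H^{1/2}_0(S¹, N)` plays no role, since its plots are exactly the smooth
maps into the Hilbert space with values in it (`isPlot_reflexiveCompletion_iff`). Indeed a plot
composed with a bounded functional is smooth, and weak smoothness on a finite-dimensional domain
implies smoothness, by Banach–Steinhaus (`contDiff_of_weakly_contDiff`). The same functionals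
separate tangent vectors, so the forms are compatible between plots.

For the inclusion, write a smooth loop as `(1 - d²/ds²)⁻¹` applied to `f - f''`. This operator has
an `H^{1/2}`-valued kernel that is continuous in operator norm, so smooth families of loops can be
differentiated under the integral (`contDiff_ofSmoothLoop`, `fderiv_ofSmoothLoop`). Parseval turns
the pairings of smooth loops into integrals. The restriction of `B` is `ω_N` because the Levi-Civita
derivative is the tangential part of the ambient derivative (`inner_covDeriv`).

For nondegeneracy, test `X` against `hX` with `h = (X', X)`: then `∫ h² = 0`, so `|X|²` is constant,
and it vanishes at the base point (`eq_zero_of_omegaN_eq_zero`). -/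

namespace HalfLoop

/-! ### Weakly smooth maps into a Hilbert space are smooth. -/

section WeakSmooth

variable {E : Type*} [NormedAddCommGroup E] [NormedSpace ℝ E] [FiniteDimensional ℝ E]
  {H : Type*} [NormedAddCommGroup H] [InnerProductSpace ℝ H] [CompleteSpace H]

/-- A map into a Hilbert space which is weakly `C¹` is locally Lipschitz at every point. -/
lemma exists_norm_sub_le_of_weakly_contDiff {p : E → H}
    (hp : ∀ h : H, ContDiff ℝ 1 fun x => inner ℝ h (p x)) (x : E) :
    ∃ C : ℝ, ∀ y ∈ Metric.ball x 1, ‖p y - p x‖ ≤ C * ‖y - x‖ := by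
  -- The difference quotients are viewed as functionals of `h`. For each `h` the mean value
  -- inequality bounds them, and Banach–Steinhaus then makes the bound uniform in `h`. At `y = x`
  -- the quotient is `0`, as `0⁻¹ = 0`.
  have hb : ∀ h : H, ∃ C, ∀ y : Metric.ball x 1,
      ‖innerSL ℝ (‖(y : E) - x‖⁻¹ • (p y - p x)) h‖ ≤ C := by
    intro h
    have hc : Continuous (fderiv ℝ fun x => inner ℝ h (p x)) := (hp h).continuous_fderiv one_ne_zero
    obtain ⟨C, hC⟩ := (isCompact_closedBall x 1).exists_bound_of_continuousOn hc.continuousOn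
    refine ⟨C, fun y => ?_⟩
    have hC0 : 0 ≤ C := (norm_nonneg _).trans (hC x (Metric.mem_closedBall_self zero_le_one))
    have h1 := (convex_ball x (1 : ℝ)).norm_image_sub_le_of_norm_fderiv_le (𝕜 := ℝ)
      (fun z _ => (hp h).differentiable one_ne_zero z)
      (fun z hz => hC z (Metric.ball_subset_closedBall hz)) (Metric.mem_ball_self one_pos) y.2
    rw [innerSL_apply_apply, real_inner_comm, inner_smul_right, inner_sub_right, norm_mul, norm_inv, norm_norm]
    by_cases hy : ‖(y : E) - x‖ = 0
    · simpa [hy] using hC0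
    · have : 0 < ‖(y : E) - x‖ := lt_of_le_of_ne (norm_nonneg _) (Ne.symm hy)
      rw [inv_mul_le_iff₀ this, mul_comm]
      exact h1
  obtain ⟨C, hC⟩ := banach_steinhaus hb
  refine ⟨C, fun y hy => ?_⟩
  have := hC ⟨y, hy⟩
  rw [innerSL_apply_norm, norm_smul, norm_inv, norm_norm] at this
  by_cases h0 : ‖y - x‖ = 0
  · rw [norm_eq_zero, sub_eq_zero] at h0
    simp [h0]
  · have h0' : 0 < ‖y - x‖ := lt_of_le_of_ne (norm_nonneg _) (Ne.symm h0)
    rwa [inv_mul_le_iff₀ h0', mul_comm] at this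

/-- The weak derivative of a weakly differentiable map into a Hilbert space. -/
lemma exists_weak_fderiv {p : E → H} (hp : ∀ h : H, ContDiff ℝ 1 fun x => inner ℝ h (p x)) (x : E) :
    ∃ L : E →L[ℝ] H, ∀ (h : H) (v : E),
      inner ℝ h (L v) = fderiv ℝ (fun y => inner ℝ h (p y)) x v := by
  have key : ∀ v : E, ∃ w : H, ∀ h : H,
      inner ℝ h w = fderiv ℝ (fun y => inner ℝ h (p y)) x v := by
    intro v
    -- The directional derivative, as a function of `h`, is a pointwise limit of bounded
    -- functionals, hence itself bounded; Riesz represents it by a vector.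
    have hlim : Filter.Tendsto
        (fun (t : ℝ) (h : H) => innerSL ℝ (t⁻¹ • (p (x + t • v) - p x)) h) (𝓝[≠] 0)
        (𝓝 fun h => fderiv ℝ (fun y => inner ℝ h (p y)) x v) := by
      rw [tendsto_pi_nhds]
      intro h
      have hd := ((hp h).differentiable one_ne_zero x).hasFDerivAt.hasLineDerivAt v
      refine hd.tendsto_slope_zero.congr fun t => ?_
      simp [real_inner_comm h]
    refine ⟨(InnerProductSpace.toDual ℝ H).symm (continuousLinearMapOfTendsto _ hlim), fun h => ?_⟩
    rw [real_inner_comm, InnerProductSpace.toDual_symm_apply]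
    rfl
  choose w hw using key
  let L : E →ₗ[ℝ] H :=
    { toFun := w
      map_add' := fun a b => ext_inner_left ℝ fun h => by simp [inner_add_right, hw]
      map_smul' := fun c a => ext_inner_left ℝ fun h => by simp [inner_smul_right, hw] }
  exact ⟨L.toContinuousLinearMap, fun h v => hw v h⟩

omit [FiniteDimensional ℝ E] [CompleteSpace H] in
lemma contDiff_inner_fderiv_apply {p : E → H} (hp : ∀ h : H, ContDiff ℝ ∞ fun x => inner ℝ h (p x))
    {L : E → E →L[ℝ] H}
    (hL : ∀ x h v, inner ℝ h (L x v) = fderiv ℝ (fun y => inner ℝ h (p y)) x v) (v : E) (h : H) :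
    ContDiff ℝ ∞ fun x => inner ℝ h (L x v) := by
  simp only [hL]
  exact ((hp h).fderiv_right (by simp)).clm_apply contDiff_const

lemma hasFDerivAt_of_weakly_contDiff {p : E → H}
    (hp : ∀ h : H, ContDiff ℝ ∞ fun x => inner ℝ h (p x)) {L : E → E →L[ℝ] H}
    (hL : ∀ x h v, inner ℝ h (L x v) = fderiv ℝ (fun y => inner ℝ h (p y)) x v) (x : E) :
    HasFDerivAt p (L x) x := by
  -- As `E` is finite-dimensional, norm continuity of `L` can be tested on each vector `v`; there `x
  -- ↦ L x v` is again weakly smooth, so the Lipschitz estimate applies.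
  have hcont : Continuous L := by
    rw [continuous_clm_apply]
    refine fun v => continuous_iff_continuousAt.2 fun y => ?_
    obtain ⟨C, hC⟩ := exists_norm_sub_le_of_weakly_contDiff
      (fun h => (contDiff_inner_fderiv_apply hp hL v h).of_le (by simp)) y
    rw [ContinuousAt, tendsto_iff_norm_sub_tendsto_zero]
    have h0 : Filter.Tendsto (fun z => C * ‖z - y‖) (𝓝 y) (𝓝 0) := by
      have : Continuous fun z : E => C * ‖z - y‖ := by fun_prop
      simpa using this.tendsto y
    refine squeeze_zero' (Filter.Eventually.of_forall fun _ => norm_nonneg _) ?_ h0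
    filter_upwards [Metric.ball_mem_nhds y one_pos] with z hz using hC z hz
  rw [hasFDerivAt_iff_isLittleO, Asymptotics.isLittleO_iff]
  intro ε hε
  obtain ⟨δ, hδ, hball⟩ := Metric.continuousAt_iff.1 hcont.continuousAt ε hε
  filter_upwards [Metric.ball_mem_nhds x hδ] with y hy
  -- The scalar mean value inequality gives a bound depending on `h` only through `‖h‖`; taking `h`
  -- to be the remainder itself then bounds its norm.
  have main : ∀ h : H, ‖inner ℝ h (p y - p x - L x (y - x))‖ ≤ ε * ‖h‖ * ‖y - x‖ := by
    intro h
    have h1 := (convex_ball x δ).norm_image_sub_le_of_norm_hasFDerivWithin_le' (𝕜 := ℝ)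
      (f := fun y => inner ℝ h (p y)) (f' := fun z => fderiv ℝ (fun y => inner ℝ h (p y)) z)
      (φ := fderiv ℝ (fun y => inner ℝ h (p y)) x) (C := ε * ‖h‖)
      (fun z _ => ((hp h).differentiable (by simp) z).hasFDerivAt.hasFDerivWithinAt) ?_
      (Metric.mem_ball_self hδ) hy
    · rwa [← hL, ← inner_sub_right, ← inner_sub_right] at h1
    · intro z hz
      refine ContinuousLinearMap.opNorm_le_bound _ (by positivity) fun v => ?_
      rw [sub_apply, ← hL, ← hL, ← inner_sub_right,
        ← sub_apply]
      have h2 : ‖L z - L x‖ ≤ ε := by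
        rw [← dist_eq_norm]; exact (hball hz).le
      calc ‖inner ℝ h ((L z - L x) v)‖ ≤ ‖h‖ * ‖(L z - L x) v‖ := norm_inner_le_norm _ _
        _ ≤ ‖h‖ * (ε * ‖v‖) := by
          gcongr
          exact (L z - L x).le_of_opNorm_le h2 v
        _ = ε * ‖h‖ * ‖v‖ := by ring
  have h3 := main (p y - p x - L x (y - x))
  rw [real_inner_self_eq_norm_sq, norm_pow, norm_norm] at h3
  by_cases h0 : ‖p y - p x - L x (y - x)‖ = 0
  · rw [h0]; positivity
  · have : 0 < ‖p y - p x - L x (y - x)‖ := lt_of_le_of_ne (norm_nonneg _) (Ne.symm h0)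
    nlinarith

/-- A weakly smooth map from a finite-dimensional space to a Hilbert space is smooth. -/
theorem contDiff_of_weakly_contDiff {p : E → H}
    (hp : ∀ h : H, ContDiff ℝ ∞ fun x => inner ℝ h (p x)) : ContDiff ℝ ∞ p := by
  refine contDiff_infty.2 fun n => ?_
  induction n generalizing p with
  | zero =>
    choose L hL using exists_weak_fderiv (fun h => (hp h).of_le (m := 1) (by simp))
    exact contDiff_zero.2 (continuous_iff_continuousAt.2 fun x =>
      (hasFDerivAt_of_weakly_contDiff hp hL x).continuousAt)
  | succ n ih =>
    choose L hL using exists_weak_fderiv (fun h => (hp h).of_le (m := 1) (by simp))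
    have hd := hasFDerivAt_of_weakly_contDiff hp hL
    have hf : fderiv ℝ p = L := funext fun x => (hd x).fderiv
    push_cast
    rw [contDiff_succ_iff_fderiv_apply]
    refine ⟨fun x => (hd x).differentiableAt, by simp, fun v => ?_⟩
    rw [hf]
    -- Each directional derivative of `p` is weakly smooth, so the induction applies to it in place
    -- of `p`.
    exact ih fun h => contDiff_inner_fderiv_apply hp hL v h

end WeakSmooth

/-! ### Smooth dependence of integrals on parameters. -/

section ParametricIntegral

variable {X : Type*} [NormedAddCommGroup X] [NormedSpace ℝ X]
  {V : Type*} [NormedAddCommGroup V] [NormedSpace ℝ V]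
  {W : Type*} [NormedAddCommGroup W] [NormedSpace ℝ W]

lemma contDiff_fderiv_left_apply {G : X → ℝ → V} (hG : ContDiff ℝ ∞ fun z : X × ℝ => G z.1 z.2)
    (v : X) : ContDiff ℝ ∞ fun z : X × ℝ => fderiv ℝ (fun y => G y z.2) z.1 v :=
  ContDiff.fderiv_apply (f := fun (z : X × ℝ) y => G y z.2)
    (hG.comp (contDiff_snd.prodMk (contDiff_snd.comp contDiff_fst))) contDiff_fst contDiff_const
    (by simp)

lemma continuous_fderiv_left {G : X → ℝ → V} (hG : ContDiff ℝ ∞ fun z : X × ℝ => G z.1 z.2) :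
    Continuous fun z : X × ℝ => fderiv ℝ (fun y => G y z.2) z.1 :=
  (ContDiff.fderiv (f := fun (z : X × ℝ) y => G y z.2) (n := 0) (m := ∞)
    (hG.comp (contDiff_snd.prodMk (contDiff_snd.comp contDiff_fst))) contDiff_fst
    (by simp)).continuous

variable [FiniteDimensional ℝ X]

/-- Differentiation under the integral sign, for a smooth family integrated against a continuous
kernel. -/
lemma hasFDerivAt_integral_kernel {K : ℝ → V →L[ℝ] W} (hK : Continuous K) {G : X → ℝ → V}
    (hG : ContDiff ℝ ∞ fun z : X × ℝ => G z.1 z.2) (x : X) :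
    HasFDerivAt (fun y => ∫ s in (0 : ℝ)..1, K s (G y s))
      (∫ s in (0 : ℝ)..1, (K s).comp (fderiv ℝ (fun y => G y s) x)) x := by
  have hD := continuous_fderiv_left hG
  have hKD : Continuous fun z : X × ℝ => (K z.2).comp (fderiv ℝ (fun y => G y z.2) z.1) :=
    (hK.comp continuous_snd).clm_comp hD
  -- Compactness of the unit ball times `[0, 1]` provides a constant dominating function.
  obtain ⟨C, hC⟩ := ((isCompact_closedBall x 1).prod (isCompact_Icc (a := (0 : ℝ)) (b := 1))
    ).exists_bound_of_continuousOn hKD.continuousOn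
  have hKG : ∀ y, Continuous fun s => K s (G y s) := fun y =>
    hK.clm_apply (hG.continuous.comp (Continuous.prodMk_right y))
  have hKD' : Continuous fun s => (K s).comp (fderiv ℝ (fun y => G y s) x) :=
    hKD.comp (Continuous.prodMk_right x)
  refine intervalIntegral.hasFDerivAt_integral_of_dominated_of_fderiv_le
    (F := fun y s => K s (G y s)) (F' := fun y s => (K s).comp (fderiv ℝ (fun y => G y s) y))
    (bound := fun _ => C) (Metric.ball_mem_nhds x one_pos)
    (Filter.Eventually.of_forall fun y => (hKG y).aestronglyMeasurable)
    ((hKG x).intervalIntegrable _ _) hKD'.aestronglyMeasurable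
    (Filter.Eventually.of_forall fun s hs y hy => ?_) intervalIntegrable_const
    (Filter.Eventually.of_forall fun s hs y hy => ?_)
  · rw [Set.uIoc_of_le zero_le_one] at hs
    exact hC (y, s) ⟨Metric.ball_subset_closedBall hy, hs.1.le, hs.2⟩
  · have h1 : ContDiff ℝ ∞ fun y => G y s := hG.comp (contDiff_id.prodMk contDiff_const)
    exact (K s).hasFDerivAt.comp y (h1.differentiable (by simp) y).hasFDerivAt

lemma fderiv_integral_kernel_apply {K : ℝ → V →L[ℝ] W} (hK : Continuous K) {G : X → ℝ → V}
    (hG : ContDiff ℝ ∞ fun z : X × ℝ => G z.1 z.2) (x v : X) :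
    fderiv ℝ (fun y => ∫ s in (0 : ℝ)..1, K s (G y s)) x v
      = ∫ s in (0 : ℝ)..1, K s (fderiv ℝ (fun y => G y s) x v) := by
  have hKD : Continuous fun s => (K s).comp (fderiv ℝ (fun y => G y s) x) :=
    hK.clm_comp ((continuous_fderiv_left hG).comp (Continuous.prodMk_right x))
  rw [(hasFDerivAt_integral_kernel hK hG x).fderiv,
    ContinuousLinearMap.intervalIntegral_apply (hKD.intervalIntegrable _ _)]
  rfl

/-- The integral of a smooth family against a continuous kernel is smooth in the parameter. -/
theorem contDiff_integral_kernel {K : ℝ → V →L[ℝ] W} (hK : Continuous K) {G : X → ℝ → V}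
    (hG : ContDiff ℝ ∞ fun z : X × ℝ => G z.1 z.2) :
    ContDiff ℝ ∞ fun y => ∫ s in (0 : ℝ)..1, K s (G y s) := by
  refine contDiff_infty.2 fun n => ?_
  induction n generalizing G with
  | zero =>
    exact contDiff_zero.2 (continuous_iff_continuousAt.2 fun x =>
      (hasFDerivAt_integral_kernel hK hG x).continuousAt)
  | succ n ih =>
    push_cast
    rw [contDiff_succ_iff_fderiv_apply]
    refine ⟨fun x => (hasFDerivAt_integral_kernel hK hG x).differentiableAt, by simp, fun v => ?_⟩
    simp only [fderiv_integral_kernel_apply hK hG]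
    exact ih (contDiff_fderiv_left_apply hG v)

end ParametricIntegral

/-! ### The pairing `⟨u', v⟩` as a bounded skew form on `H^{1/2}`. -/

section SobolevMaps

lemma hasSum_of_forall_eq {f g : ℤ → ℝ} {a : ℝ} (h : ∀ n, f n = g n) (hg : HasSum g a) :
    HasSum f a := by
  rwa [funext h]

variable {V : Type*} [NormedAddCommGroup V] [InnerProductSpace ℂ V] {s : ℝ}

lemma Sobolev.coeff_add (u v : Sobolev s V) (n : ℤ) : (u + v).coeff n = u.coeff n + v.coeff n :=
  smul_add _ (u.seq n : V) (v.seq n)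

lemma Sobolev.coeff_smul (c : ℝ) (u : Sobolev s V) (n : ℤ) : (c • u).coeff n = c • u.coeff n := by
  have h : (c • u).seq n = (c : ℂ) • (u.seq n : V) := rfl
  rw [Sobolev.coeff, h, Complex.coe_smul, smul_comm]
  rfl

lemma Sobolev.ext_coeff {u v : Sobolev s V} (h : ∀ n, u.coeff n = v.coeff n) : u = v := by
  refine lp.ext (funext fun n => ?_)
  exact smul_right_injective V (Real.rpow_pos_of_pos (weight_pos n) (-s)).ne' (h n)

lemma Sobolev.norm_coeff_le (u : Sobolev s V) (n : ℤ) : ‖u.coeff n‖ ≤ weight n ^ (-s) * ‖u‖ := by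
  rw [Sobolev.coeff, norm_smul, Real.norm_of_nonneg (Real.rpow_nonneg (weight_pos n).le _)]
  exact mul_le_mul_of_nonneg_left (lp.norm_apply_le_norm two_ne_zero u.seq n)
    (Real.rpow_nonneg (weight_pos n).le _)

/-- The `n`-th Fourier coefficient, as a continuous real-linear map. -/
noncomputable def coeffCLM (s : ℝ) (V : Type*) [NormedAddCommGroup V] [InnerProductSpace ℂ V]
    (n : ℤ) : Sobolev s V →L[ℝ] V :=
  LinearMap.mkContinuous
    { toFun := fun u => u.coeff n
      map_add' := fun u v => u.coeff_add v n
      map_smul' := fun c u => Sobolev.coeff_smul c u n } (weight n ^ (-s)) fun u =>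
    u.norm_coeff_le n

@[simp]
lemma coeffCLM_apply (n : ℤ) (u : Sobolev s V) : coeffCLM s V n u = u.coeff n := rfl

/-- On stored sequences the derivative multiplies by `2πin / (1 + |n|)`, whose modulus is at most
`2π`. -/
lemma norm_derivHalf_le (u : Sobolev (1 / 2) V) : ‖derivHalf u‖ ≤ 2 * Real.pi * ‖u‖ := by
  have h1 : ‖derivHalf u‖ ≤ ‖(2 * Real.pi : ℂ) • u‖ := by
    refine lp.norm_mono (p := 2) two_ne_zero (x := (derivHalf u).seq)
      (y := ((2 * Real.pi : ℂ) • u : Sobolev (1 / 2) V).seq) fun n => ?_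
    have e1 : (derivHalf u).seq n
      = (((weight n)⁻¹ : ℝ) * (2 * Real.pi * Complex.I * n) : ℂ) • (u.seq n : V) := rfl
    have e2 : ((2 * Real.pi : ℂ) • u : Sobolev (1 / 2) V).seq n
      = (2 * Real.pi : ℂ) • (u.seq n : V) := rfl
    have hw := weight_pos n
    have h1 : |(n : ℝ)| ≤ weight n := by unfold weight; linarith
    rw [e1, e2, norm_smul, norm_smul]
    gcongr
    simp only [norm_mul, Complex.norm_real, Complex.norm_I, Complex.norm_intCast, norm_inv,
      Complex.norm_ofNat, Real.norm_eq_abs, abs_of_pos hw, abs_of_pos Real.pi_pos]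
    rw [inv_mul_le_iff₀ hw]
    nlinarith [Real.pi_pos]
  rw [norm_smul] at h1
  simpa [abs_of_pos Real.pi_pos] using h1

lemma abs_pairing_le (a : Sobolev (-s) V) (b : Sobolev s V) : ‖pairing a b‖ ≤ ‖a‖ * ‖b‖ :=
  (Complex.abs_re_le_norm _).trans (norm_inner_le_norm (𝕜 := ℂ) a.seq b.seq)

/-- The bilinear form `(u, v) ↦ ⟨u', v⟩` on `H^{1/2}`. -/
noncomputable def derivPairing (V : Type*) [NormedAddCommGroup V] [InnerProductSpace ℂ V] :
    Sobolev (1 / 2) V →L[ℝ] Sobolev (1 / 2) V →L[ℝ] ℝ :=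
  LinearMap.mkContinuous₂
    (LinearMap.mk₂ ℝ (fun u v => pairing (derivHalf u) v)
      (fun u u' v => (hasSum_pairing _ _).unique <| by
        refine hasSum_of_forall_eq (fun n => ?_) ((hasSum_pairing (derivHalf u) v).add (hasSum_pairing (derivHalf u') v))
        simp [coeff_derivHalf, Sobolev.coeff_add, smul_add])
      (fun c u v => (hasSum_pairing _ _).unique <| by
        refine hasSum_of_forall_eq (fun n => ?_) ((hasSum_pairing (derivHalf u) v).mul_left c)
        rw [coeff_derivHalf, Sobolev.coeff_smul, smul_comm, ← Complex.coe_smul, inner_smul_left,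
          ← coeff_derivHalf]
        simp)
      (fun u v v' => (hasSum_pairing _ _).unique <| by
        refine hasSum_of_forall_eq (fun n => ?_) ((hasSum_pairing (derivHalf u) v).add (hasSum_pairing (derivHalf u) v'))
        simp [Sobolev.coeff_add])
      (fun c u v => (hasSum_pairing _ _).unique <| by
        refine hasSum_of_forall_eq (fun n => ?_) ((hasSum_pairing (derivHalf u) v).mul_left c)
        rw [Sobolev.coeff_smul, ← Complex.coe_smul, inner_smul_right]
        simp))
    (2 * Real.pi) fun u v =>
      (abs_pairing_le _ _).trans (mul_le_mul_of_nonneg_right (norm_derivHalf_le u) (norm_nonneg _))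

lemma derivPairing_apply (u v : Sobolev (1 / 2) V) :
    derivPairing V u v = pairing (derivHalf u) v := rfl

/-- The symbol `2πin` is purely imaginary, so each Fourier term changes sign under exchange of the
arguments. -/
lemma derivPairing_skew (u v : Sobolev (1 / 2) V) :
    derivPairing V u v = - derivPairing V v u := by
  rw [derivPairing_apply, derivPairing_apply]
  refine (hasSum_pairing _ _).unique ?_
  refine hasSum_of_forall_eq (fun n => ?_) (hasSum_pairing (derivHalf v) u).neg
  rw [coeff_derivHalf, coeff_derivHalf, inner_smul_left, inner_smul_left,
    ← inner_conj_symm (v.coeff n)]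
  generalize inner ℂ (u.coeff n) (v.coeff n) = z
  simp

end SobolevMaps

/-! ### Fourier coefficients of periodic functions and Parseval's identity. -/

section Fourier

variable {V : Type*} [NormedAddCommGroup V] [InnerProductSpace ℂ V]

lemma periodic_deriv {f : ℝ → V} (hp : Function.Periodic f 1) : Function.Periodic (deriv f) 1 := by
  intro t
  rw [← deriv_comp_add_const f 1 t]
  exact congrArg (deriv · t) (funext hp)

/-- Integration by parts against the exponential; the boundary terms cancel because both factors are
`1`-periodic. -/
lemma loopCoeff_deriv [CompleteSpace V] {f : ℝ → V} (hf : ContDiff ℝ 1 f)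
    (hp : Function.Periodic f 1) (n : ℤ) :
    loopCoeff (deriv f) n = (2 * Real.pi * Complex.I * n : ℂ) • loopCoeff f n := by
  set k : ℂ := 2 * Real.pi * Complex.I * n with hk
  have hc1 : Continuous (deriv f) := hf.continuous_deriv le_rfl
  have he : ∀ t : ℝ, HasDerivAt (fun t : ℝ => Complex.exp (-k * t))
      (Complex.exp (-k * t) * (-k)) t := by
    intro t
    have h1 : HasDerivAt (fun z : ℂ => Complex.exp (-k * z)) (Complex.exp (-k * t) * (-k)) t := by
      have := (hasDerivAt_id (t : ℂ)).const_mul (-k)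
      simpa using this.cexp
    exact h1.comp_ofReal
  have hF : ∀ t : ℝ, HasDerivAt (fun t : ℝ => Complex.exp (-k * t) • f t)
      (Complex.exp (-k * t) • deriv f t - k • (Complex.exp (-k * t) • f t)) t := by
    intro t
    have h := (he t).smul (hf.differentiable one_ne_zero t).hasDerivAt
    have e : Complex.exp (-k * t) • deriv f t - k • (Complex.exp (-k * t) • f t)
        = Complex.exp (-k * t) • deriv f t + (Complex.exp (-k * t) * (-k)) • f t := by module
    rw [e]
    exact h
  have hce : Continuous fun t : ℝ => Complex.exp (-k * t) := by fun_prop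
  have i1 : IntervalIntegrable (fun t : ℝ => Complex.exp (-k * t) • deriv f t)
    MeasureTheory.volume 0 1 := (hce.smul hc1).intervalIntegrable _ _
  have i2 : IntervalIntegrable (fun t : ℝ => k • (Complex.exp (-k * t) • f t))
    MeasureTheory.volume 0 1 := ((hce.smul hf.continuous).const_smul _).intervalIntegrable _ _
  have hI := intervalIntegral.integral_eq_sub_of_hasDerivAt (fun t _ => hF t) (i1.sub i2)
  have e1 : Complex.exp (-k * (1 : ℝ)) = 1 := by
    rw [Complex.exp_eq_one_iff]
    exact ⟨-n, by rw [hk]; push_cast; ring⟩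
  have hp0 : f 1 = f 0 := by simpa using hp 0
  rw [e1, hp0, intervalIntegral.integral_sub i1 i2, intervalIntegral.integral_smul] at hI
  simp only [Complex.ofReal_zero, mul_zero, Complex.exp_zero, sub_self] at hI
  rw [loopCoeff_eq, loopCoeff_eq]
  exact sub_eq_zero.1 hI

lemma loopCoeff_add {f g : ℝ → V} (hf : Continuous f) (hg : Continuous g) (n : ℤ) :
    loopCoeff (fun t => f t + g t) n = loopCoeff f n + loopCoeff g n := by
  simp only [loopCoeff_eq, smul_add]
  exact intervalIntegral.integral_add
    (Continuous.intervalIntegrable (by fun_prop) _ _) (Continuous.intervalIntegrable (by fun_prop) _ _)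

lemma loopCoeff_sub {f g : ℝ → V} (hf : Continuous f) (hg : Continuous g) (n : ℤ) :
    loopCoeff (fun t => f t - g t) n = loopCoeff f n - loopCoeff g n := by
  simp only [loopCoeff_eq, smul_sub]
  exact intervalIntegral.integral_sub
    (Continuous.intervalIntegrable (by fun_prop) _ _) (Continuous.intervalIntegrable (by fun_prop) _ _)

/-- The symbol of `1 - d²/ds²` is real and at least `1`, hence invertible on every mode. -/
lemma loopCoeff_sub_deriv_deriv [CompleteSpace V] {f : ℝ → V} (hf : ContDiff ℝ ∞ f)
    (hp : Function.Periodic f 1) (n : ℤ) :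
    loopCoeff (fun t => f t - deriv (deriv f) t) n
      = (1 + (2 * Real.pi * n) ^ 2 : ℝ) • loopCoeff f n := by
  have hf1 : ContDiff ℝ ∞ (deriv f) := ContDiff.deriv' (by simpa using hf)
  rw [loopCoeff_sub hf.continuous (hf1.continuous_deriv (by simp)),
    loopCoeff_deriv (hf1.of_le (by simp)) (periodic_deriv hp), loopCoeff_deriv (hf.of_le (by simp)) hp,
    smul_smul, ← Complex.coe_smul]
  have e : (((1 + (2 * Real.pi * n) ^ 2 : ℝ)) : ℂ)
      = 1 - (2 * Real.pi * Complex.I * n) * (2 * Real.pi * Complex.I * n) := by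
    push_cast
    linear_combination (4 * (Real.pi : ℂ) ^ 2 * n ^ 2) * Complex.I_sq
  rw [e, sub_smul, one_smul]

lemma continuousLinearMap_loopCoeff [CompleteSpace V] {W : Type*} [NormedAddCommGroup W]
    [InnerProductSpace ℂ W] [CompleteSpace W] (L : V →L[ℂ] W) {f : ℝ → V} (hf : Continuous f)
    (n : ℤ) : loopCoeff (fun t => L (f t)) n = L (loopCoeff f n) := by
  rw [loopCoeff_eq, loopCoeff_eq, ← L.intervalIntegral_comp_comm
    (Continuous.intervalIntegrable (by fun_prop) _ _)]
  simp

section Parseval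

variable [FiniteDimensional ℂ V]

/-- Parseval's identity for continuous functions with values in a finite-dimensional space. -/
lemma hasSum_norm_sq_loopCoeff {f : ℝ → V} (hf : Continuous f) :
    HasSum (fun n => ‖loopCoeff f n‖ ^ 2) (∫ t in (0 : ℝ)..1, ‖f t‖ ^ 2) := by
  have := FiniteDimensional.complete ℂ V
  let b := stdOrthonormalBasis ℂ V
  have hb : ∀ v : V, ‖v‖ ^ 2 = ∑ i, ‖innerSL ℂ (b i) v‖ ^ 2 := fun v => by
    simpa using (b.sum_sq_norm_inner_right v).symm
  have hc : ∀ i, Continuous fun t => innerSL ℂ (b i) (f t) := fun i => by fun_prop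
  -- Scalar Parseval for each component in an orthonormal basis; the finitely many components are
  -- then summed.
  have hi : ∀ i, HasSum (fun n => ‖innerSL ℂ (b i) (loopCoeff f n)‖ ^ 2)
      (∫ t in (0 : ℝ)..1, ‖innerSL ℂ (b i) (f t)‖ ^ 2) := by
    intro i
    have h2 : MeasureTheory.MemLp (fun t => innerSL ℂ (b i) (f t)) 2
        (MeasureTheory.volume.restrict (Set.Ioc (0 : ℝ) 1)) := by
      obtain ⟨C, hC⟩ := (isCompact_Icc (a := (0 : ℝ)) (b := 1)).exists_bound_of_continuousOn
        (hc i).continuousOn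
      refine MeasureTheory.MemLp.of_bound (hc i).aestronglyMeasurable C ?_
      filter_upwards [MeasureTheory.ae_restrict_mem measurableSet_Ioc] with t ht
      exact hC t ⟨ht.1.le, ht.2⟩
    have := hasSum_sq_fourierCoeffOn (zero_lt_one' ℝ) h2
    simp only [sub_zero, inv_one, one_smul] at this
    convert this using 3 with n
    rw [← continuousLinearMap_loopCoeff _ hf]
    rfl
  have := hasSum_sum fun i (_ : i ∈ Finset.univ) => hi i
  rw [← intervalIntegral.integral_finsetSum fun i _ =>
    Continuous.intervalIntegrable (by fun_prop) _ _] at this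
  simpa only [hb] using this

/-- Polarization of Parseval's identity, applied to `f + g` and `f - g`. -/
lemma hasSum_re_inner_loopCoeff {f g : ℝ → V} (hf : Continuous f) (hg : Continuous g) :
    HasSum (fun n => (inner ℂ (loopCoeff f n) (loopCoeff g n)).re)
      (∫ t in (0 : ℝ)..1, (inner ℂ (f t) (g t)).re) := by
  have hpol : ∀ u v : V, (inner ℂ u v).re = (1 / 4) * (‖u + v‖ ^ 2 - ‖u - v‖ ^ 2) := fun u v => by
    have := re_inner_eq_norm_add_mul_self_sub_norm_sub_mul_self_div_four (𝕜 := ℂ) u v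
    simp only [RCLike.re_to_complex] at this
    rw [this]; ring
  have h := ((hasSum_norm_sq_loopCoeff (f := fun t => f t + g t) (hf.add hg)).sub
    (hasSum_norm_sq_loopCoeff (f := fun t => f t - g t) (hf.sub hg))).mul_left (1 / 4)
  rw [← intervalIntegral.integral_sub (Continuous.intervalIntegrable (by fun_prop) _ _)
    (Continuous.intervalIntegrable (by fun_prop) _ _),
    ← intervalIntegral.integral_const_mul] at h
  simpa only [loopCoeff_add hf hg, loopCoeff_sub hf hg, hpol] using h

/-- The duality pairing of the derivative of a smooth loop with a smooth loop is an integral. -/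
lemma pairing_derivHalf_ofSmoothLoop {f g : ℝ → V} (hf : ContDiff ℝ ∞ f)
    (hfp : Function.Periodic f 1) (hg : ContDiff ℝ ∞ g) (hgp : Function.Periodic g 1) :
    pairing (derivHalf (ofSmoothLoop f hf hfp)) (ofSmoothLoop g hg hgp)
      = ∫ t in (0 : ℝ)..1, (inner ℂ (deriv f t) (g t)).re := by
  have := FiniteDimensional.complete ℂ V
  refine (hasSum_pairing _ _).unique (hasSum_of_forall_eq (fun n => ?_)
    (hasSum_re_inner_loopCoeff (hf.continuous_deriv (by simp)) hg.continuous))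
  rw [coeff_derivHalf, coeff_ofSmoothLoop, coeff_ofSmoothLoop, loopCoeff_deriv (hf.of_le (by simp)) hfp]

end Parseval

end Fourier

/-! ### Smooth families of loops as smooth maps into `H^{1/2}`. -/

section SmoothFamilies

variable {V : Type*} [NormedAddCommGroup V] [InnerProductSpace ℂ V]

/-- The inclusion `v ↦ δₙ v` of the `n`-th coordinate. -/
noncomputable def singleMode (V : Type*) [NormedAddCommGroup V] [InnerProductSpace ℂ V] (n : ℤ) :
    V →ₗ[ℝ] Sobolev (1 / 2) V where
  toFun v := Sobolev.ofSeq (lp.single (E := fun _ : ℤ => V) 2 n v)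
  map_add' u v := lp.single_add (E := fun _ : ℤ => V) 2 n u v
  map_smul' c u := lp.single_smul (E := fun _ : ℤ => V) 2 n (c : ℂ) u

/-- The inclusion of the `n`-th Fourier mode in `H^{1/2}`, divided by the symbol `1 + (2πn)²` of
`1 - d²/ds²`. -/
noncomputable def resolventMode (V : Type*) [NormedAddCommGroup V] [InnerProductSpace ℂ V] (n : ℤ) :
    V →L[ℝ] Sobolev (1 / 2) V :=
  -- The numerator converts a Fourier coefficient into an entry of the stored sequence.
  (weight n ^ (1 / 2 : ℝ) / (1 + (2 * Real.pi * n) ^ 2)) •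
    (singleMode V n).mkContinuous 1 fun v => by
      rw [one_mul]
      exact (lp.norm_single (E := fun _ : ℤ => V) (p := 2) (by norm_num) n v).le

lemma coeff_resolventMode_self (n : ℤ) (v : V) :
    (resolventMode V n v).coeff n = (1 + (2 * Real.pi * n) ^ 2)⁻¹ • v := by
  have hw := weight_pos n
  have h : (singleMode V n v).seq n = v :=
    lp.single_apply_self (E := fun _ : ℤ => V) 2 n v
  change ((_ : ℝ) • (singleMode V n v)).coeff n = _
  rw [Sobolev.coeff_smul, Sobolev.coeff, h, smul_smul, div_eq_mul_inv, mul_assoc,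
    mul_comm _ (weight n ^ _), ← mul_assoc, ← Real.rpow_add hw]
  simp

lemma coeff_resolventMode_of_ne {m n : ℤ} (hmn : m ≠ n) (v : V) :
    (resolventMode V n v).coeff m = 0 := by
  have h : (singleMode V n v).seq m = 0 :=
    lp.single_apply_ne (E := fun _ : ℤ => V) 2 n v hmn
  change ((_ : ℝ) • (singleMode V n v)).coeff m = _
  rw [Sobolev.coeff_smul, Sobolev.coeff, h, smul_zero, smul_zero]

lemma norm_resolventMode_le (n : ℤ) :
    ‖resolventMode V n‖ ≤ weight n ^ (1 / 2 : ℝ) / (1 + (2 * Real.pi * n) ^ 2) := by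
  have hw := weight_pos n
  rw [resolventMode, norm_smul, Real.norm_of_nonneg (by positivity)]
  exact mul_le_of_le_one_right (by positivity) (LinearMap.mkContinuous_norm_le _ zero_le_one _)

/-- The two orders gained by inverting `1 - d²/ds²` outweigh the half order of the norm: the terms
are `O(|n|^(-3/2))`. -/
lemma summable_resolventMode_bound :
    Summable fun n : ℤ => weight n ^ (1 / 2 : ℝ) / (1 + (2 * Real.pi * n) ^ 2) := by
  have hs : Summable fun n : ℤ => 2 * |(n : ℝ)| ^ (-(3 / 2) : ℝ) :=
    (Real.summable_abs_int_rpow (by norm_num)).mul_left _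
  refine hs.of_norm_bounded_eventually ?_
  filter_upwards [(Set.finite_singleton (0 : ℤ)).compl_mem_cofinite] with n hn
  have hn0 : n ≠ 0 := by simpa using hn
  have hw := weight_pos n
  have hn1 : 0 < |(n : ℝ)| := by positivity
  have h1 : weight n ^ 2 ≤ 2 * (1 + (2 * Real.pi * n) ^ 2) := by
    have hpi : 1 ≤ 2 ^ 2 * Real.pi ^ 2 := by nlinarith [Real.pi_gt_three]
    have : (n : ℝ) ^ 2 ≤ (2 * Real.pi * n) ^ 2 := by
      rw [mul_pow, mul_pow]
      exact le_mul_of_one_le_left (sq_nonneg _) hpi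
    unfold weight
    nlinarith [sq_nonneg (1 - |(n : ℝ)|), sq_abs (n : ℝ)]
  rw [Real.norm_of_nonneg (by positivity), div_le_iff₀ (by positivity)]
  have h2 : weight n ^ (1 / 2 : ℝ) = weight n ^ (-(3 / 2) : ℝ) * weight n ^ 2 := by
    rw [← Real.rpow_natCast, ← Real.rpow_add hw]; norm_num
  have h3 : weight n ^ (-(3 / 2) : ℝ) ≤ |(n : ℝ)| ^ (-(3 / 2) : ℝ) :=
    Real.rpow_le_rpow_of_nonpos hn1 (by unfold weight; linarith) (by norm_num)
  calc weight n ^ (1 / 2 : ℝ) = weight n ^ (-(3 / 2) : ℝ) * weight n ^ 2 := h2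
    _ ≤ |(n : ℝ)| ^ (-(3 / 2) : ℝ) * (2 * (1 + (2 * Real.pi * n) ^ 2)) := by gcongr
    _ = _ := by ring

/-- The kernel of the operator `(1 - d²/ds²)⁻¹`, from continuous functions to `H^{1/2}`. -/
noncomputable def resolventKernel (V : Type*) [NormedAddCommGroup V] [InnerProductSpace ℂ V]
    (t : ℝ) : V →L[ℝ] Sobolev (1 / 2) V :=
  ∑' n : ℤ, (resolventMode V n).comp
    (ContinuousLinearMap.lsmul ℝ ℂ (Complex.exp (-(2 * Real.pi * Complex.I * n) * t)))

lemma norm_resolventKernel_term_le (t : ℝ) (n : ℤ) :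
    ‖(resolventMode V n).comp
      (ContinuousLinearMap.lsmul ℝ ℂ (Complex.exp (-(2 * Real.pi * Complex.I * n) * t)))‖
      ≤ weight n ^ (1 / 2 : ℝ) / (1 + (2 * Real.pi * n) ^ 2) := by
  have hw := weight_pos n
  have e : ‖Complex.exp (-(2 * Real.pi * Complex.I * n) * t)‖ = 1 := by
    rw [Complex.norm_exp]; simp
  have h1 : ‖(ContinuousLinearMap.lsmul ℝ ℂ
      (Complex.exp (-(2 * Real.pi * Complex.I * n) * t)) : V →L[ℝ] V)‖ ≤ 1 :=
    ContinuousLinearMap.opNorm_le_bound _ zero_le_one fun v => by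
      rw [ContinuousLinearMap.lsmul_apply, norm_smul, e]
  calc _ ≤ ‖resolventMode V n‖ * _ := ContinuousLinearMap.opNorm_comp_le _ _
    _ ≤ (weight n ^ (1 / 2 : ℝ) / (1 + (2 * Real.pi * n) ^ 2)) * 1 := by
      gcongr
      exact norm_resolventMode_le n
    _ = _ := mul_one _

variable [FiniteDimensional ℂ V]

/-- Weierstrass M-test: the bound on the terms is summable and independent of `t`. -/
lemma continuous_resolventKernel : Continuous (resolventKernel V) := by
  refine continuous_tsum (fun n => ?_) summable_resolventMode_bound
    fun n t => norm_resolventKernel_term_le t n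
  exact continuous_const.clm_comp ((ContinuousLinearMap.lsmul ℝ ℂ).continuous.comp (by fun_prop))

lemma coeff_resolventKernel (t : ℝ) (v : V) (m : ℤ) :
    (resolventKernel V t v).coeff m = (1 + (2 * Real.pi * m) ^ 2 : ℝ)⁻¹ •
      (Complex.exp (-(2 * Real.pi * Complex.I * m) * t) • v) := by
  have := FiniteDimensional.complete ℂ V
  have hs : Summable fun n : ℤ => (resolventMode V n).comp
      (ContinuousLinearMap.lsmul ℝ ℂ (Complex.exp (-(2 * Real.pi * Complex.I * n) * t))) :=
    summable_resolventMode_bound.of_norm_bounded fun n => norm_resolventKernel_term_le t n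
  have h1 := (hs.hasSum.mapL (ContinuousLinearMap.apply ℝ (Sobolev (1 / 2) V) v)).mapL
    (coeffCLM (1 / 2) V m)
  refine h1.unique ?_
  convert hasSum_single m fun n hn => ?_ using 1
  · exact (coeff_resolventMode_self m _).symm
  · exact coeff_resolventMode_of_ne hn.symm _

/-- The formula expresses the embedding of loops by a kernel independent of the loop, which reduces
smoothness in parameters to differentiation under an integral. It is checked on Fourier
coefficients, where the two symbols cancel. -/
lemma ofSmoothLoop_eq_integral {f : ℝ → V} (hf : ContDiff ℝ ∞ f) (hp : Function.Periodic f 1) :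
    ofSmoothLoop f hf hp
      = ∫ t in (0 : ℝ)..1, resolventKernel V t (f t - deriv (deriv f) t) := by
  have := FiniteDimensional.complete ℂ V
  have hf1 : ContDiff ℝ ∞ (deriv f) := ContDiff.deriv' (by simpa using hf)
  have hc : Continuous fun t => f t - deriv (deriv f) t :=
    hf.continuous.sub (hf1.continuous_deriv (by simp))
  refine Sobolev.ext_coeff fun n => ?_
  rw [← coeffCLM_apply n (∫ t in (0 : ℝ)..1, _), ← ContinuousLinearMap.intervalIntegral_comp_comm _
    ((continuous_resolventKernel.clm_apply hc).intervalIntegrable _ _)]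
  simp only [coeffCLM_apply, coeff_resolventKernel]
  rw [intervalIntegral.integral_smul, ← loopCoeff_eq, loopCoeff_sub_deriv_deriv hf hp, smul_smul,
    inv_mul_cancel₀ (by positivity), one_smul, coeff_ofSmoothLoop]

variable {X : Type*} [NormedAddCommGroup X] [NormedSpace ℝ X] [FiniteDimensional ℝ X]

omit [FiniteDimensional ℂ V] [FiniteDimensional ℝ X] in
lemma contDiff_deriv_right {F : X → ℝ → V} (hF : ContDiff ℝ ∞ fun z : X × ℝ => F z.1 z.2) :
    ContDiff ℝ ∞ fun z : X × ℝ => deriv (F z.1) z.2 := by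
  simp only [← fderiv_apply_one_eq_deriv]
  exact ContDiff.fderiv_apply (f := fun (z : X × ℝ) y => F z.1 y)
    (hF.comp ((contDiff_fst.comp contDiff_fst).prodMk contDiff_snd)) contDiff_snd contDiff_const
    (by simp)

/-- A smooth family of smooth loops is a smooth map into `H^{1/2}`. -/
theorem contDiff_ofSmoothLoop {F : X → ℝ → V} (hF : ContDiff ℝ ∞ fun z : X × ℝ => F z.1 z.2)
    (hf : ∀ x, ContDiff ℝ ∞ (F x)) (hp : ∀ x, Function.Periodic (F x) 1) :
    ContDiff ℝ ∞ fun x => ofSmoothLoop (F x) (hf x) (hp x) := by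
  simp only [ofSmoothLoop_eq_integral]
  exact contDiff_integral_kernel continuous_resolventKernel
    (G := fun x t => F x t - deriv (deriv (F x)) t)
    (hF.sub (contDiff_deriv_right (F := fun x => deriv (F x)) (contDiff_deriv_right hF)))

/-- The derivative of a smooth family of smooth loops, as a map into `H^{1/2}`, is the pointwise
derivative. -/
theorem fderiv_ofSmoothLoop {F : X → ℝ → V} (hF : ContDiff ℝ ∞ fun z : X × ℝ => F z.1 z.2)
    (hf : ∀ x, ContDiff ℝ ∞ (F x)) (hp : ∀ x, Function.Periodic (F x) 1) (x v : X)
    (hf' : ContDiff ℝ ∞ fun t => fderiv ℝ (fun y => F y t) x v)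
    (hp' : Function.Periodic (fun t => fderiv ℝ (fun y => F y t) x v) 1) :
    fderiv ℝ (fun y => ofSmoothLoop (F y) (hf y) (hp y)) x v
      = ofSmoothLoop (fun t => fderiv ℝ (fun y => F y t) x v) hf' hp' := by
  -- Each coefficient is an integral against an exponential, which can be differentiated under the
  -- integral sign.
  refine Sobolev.ext_coeff fun n => ?_
  have h1 := (contDiff_ofSmoothLoop hF hf hp).differentiable (by simp) x
  rw [← coeffCLM_apply, ← ContinuousLinearMap.comp_apply,
    ← (coeffCLM (1 / 2) V n).hasFDerivAt.comp x h1.hasFDerivAt |>.fderiv]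
  have e : (coeffCLM (1 / 2) V n ∘ fun y => ofSmoothLoop (F y) (hf y) (hp y)) = fun y =>
      ∫ t in (0 : ℝ)..1, (ContinuousLinearMap.lsmul ℝ ℂ
        (Complex.exp (-(2 * Real.pi * Complex.I * n) * t)) : V →L[ℝ] V) (F y t) := by
    funext y
    simp [coeff_ofSmoothLoop, loopCoeff_eq]
  rw [e, fderiv_integral_kernel_apply _ hF, coeff_ofSmoothLoop, loopCoeff_eq]
  · rfl
  · exact (ContinuousLinearMap.lsmul ℝ ℂ).continuous.comp (by fun_prop)

end SmoothFamilies

/-! ### Plots of the reflexive completion. -/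

section Plots

variable {H : Type*} [NormedAddCommGroup H] [InnerProductSpace ℝ H] {A : Set H} {n : ℕ}

/-- The plots of the reflexive completion of a subset of a Hilbert space are the smooth maps into the
Hilbert space with values in the subset. -/
theorem isPlot_reflexiveCompletion_iff [CompleteSpace H] {p : EuclideanSpace ℝ (Fin n) → A} :
    @Diffeology.IsPlot A (reflexiveCompletion (traceDiffeology (normedDiffeology H) A)) n p ↔
      ContDiff ℝ ∞ fun x => (p x : H) := by
  constructor
  · refine fun hp => contDiff_of_weakly_contDiff fun h => ?_
    -- A bounded functional restricted to `A` is smooth for the trace diffeology, so it may be used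
    -- to test `p`.
    refine contDiffOn_univ.1 (hp (fun a : A => inner ℝ h (a : H)) fun m q hq => ?_)
    refine Diffeology.isPlot_iff_contDiff.2 (contDiffOn_univ.1 ?_)
    exact hq (fun y => inner ℝ h y) (show ContDiff ℝ ∞ (innerSL ℝ h) from (innerSL ℝ h).contDiff)
  -- Conversely, a smooth map is already a plot of the trace diffeology, and the completion keeps
  -- all such plots.
  · refine fun hp f hf => contDiffOn_univ.2 (Diffeology.isPlot_iff_contDiff.1 (hf n p ?_))
    exact fun g hg => contDiffOn_univ.2 (ContDiff.comp (g := g) hg hp)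

/-- Bounded functionals are smooth functions on `A` and separate the vectors of `H`. This is what
makes formulas in the derivative of a plot compatible between plots. -/
lemma fderiv_coe_eq_of_sameTangent [CompleteSpace H] {m : ℕ} {p : EuclideanSpace ℝ (Fin n) → A}
    {q : EuclideanSpace ℝ (Fin m) → A} (hp : ContDiff ℝ ∞ fun x => (p x : H))
    (hq : ContDiff ℝ ∞ fun x => (q x : H)) {y Y : EuclideanSpace ℝ (Fin n)}
    {z Z : EuclideanSpace ℝ (Fin m)}
    (h : @SameTangent A (reflexiveCompletion (traceDiffeology (normedDiffeology H) A)) n m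
      p q y Y z Z) :
    fderiv ℝ (fun x => (p x : H)) y Y = fderiv ℝ (fun x => (q x : H)) z Z := by
  refine ext_inner_left ℝ fun w => ?_
  have h1 := h.2 (fun a : A => inner ℝ w (a : H)) fun k r hr => Diffeology.isPlot_iff_contDiff.2
    ((innerSL ℝ w).contDiff.comp (isPlot_reflexiveCompletion_iff.1 hr))
  have e : ∀ {k : ℕ} {r : EuclideanSpace ℝ (Fin k) → A} (_ : ContDiff ℝ ∞ fun x => (r x : H))
      (x v : EuclideanSpace ℝ (Fin k)), fderiv ℝ ((fun a : A => inner ℝ w (a : H)) ∘ r) x v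
        = inner ℝ w (fderiv ℝ (fun x => (r x : H)) x v) := by
    intro k r hr x v
    have := ((innerSL ℝ w).hasFDerivAt.comp x (hr.differentiable (by simp) x).hasFDerivAt).fderiv
    exact congrArg (· v) this
  rwa [e hp, e hq] at h1

end Plots

/-! ### Exterior derivative of the form `B(u, du)`. -/

section Forms

variable {X : Type*} [NormedAddCommGroup X] [NormedSpace ℝ X]
  {H : Type*} [NormedAddCommGroup H] [NormedSpace ℝ H]

/-- The pull-back by `u : X → H` of the `1`-form `v ↦ B u v` of `H`. -/
noncomputable def bilinForm (B : H →L[ℝ] H →L[ℝ] ℝ) (u : X → H) (x : X) : X [⋀^Fin 1]→L[ℝ] ℝ :=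
  ContinuousAlternatingMap.ofSubsingletonLIE (𝕜 := ℝ) (E := X) (F := ℝ) (0 : Fin 1) ((B (u x)).comp (fderiv ℝ u x))

lemma bilinForm_apply (B : H →L[ℝ] H →L[ℝ] ℝ) (u : X → H) (x : X) (v : Fin 1 → X) :
    bilinForm B u x v = B (u x) (fderiv ℝ u x (v 0)) := rfl

lemma contDiff_bilinForm (B : H →L[ℝ] H →L[ℝ] ℝ) {u : X → H} (hu : ContDiff ℝ ∞ u) :
    ContDiff ℝ ∞ (bilinForm B u) :=
  (ContinuousAlternatingMap.ofSubsingletonLIE (𝕜 := ℝ) (E := X) (F := ℝ) (0 : Fin 1)).contDiff.comp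
    ((B.contDiff.comp hu).clm_comp (hu.fderiv_right (by simp)))

lemma contDiff_extDeriv {k : ℕ} {α : X → X [⋀^Fin k]→L[ℝ] ℝ} (hα : ContDiff ℝ ∞ α) :
    ContDiff ℝ ∞ (extDeriv α) :=
  (ContinuousAlternatingMap.alternatizeUncurryFinCLM ℝ X ℝ).contDiff.comp
    (hα.fderiv_right (by simp))

/-- The terms `B(u, D²u)` cancel by symmetry of `D²u`; what remains is `B(∂_v u, ∂_w u) - B(∂_w u,
∂_v u)`, and skewness doubles the first term. -/
lemma extDeriv_bilinForm_apply {B : H →L[ℝ] H →L[ℝ] ℝ} (hB : ∀ a b, B a b = - B b a) {u : X → H}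
    (hu : ContDiff ℝ ∞ u) (x v w : X) :
    extDeriv (bilinForm B u) x ![v, w] = 2 * B (fderiv ℝ u x v) (fderiv ℝ u x w) := by
  have hu1 : HasFDerivAt u (fderiv ℝ u x) x := (hu.differentiable (by simp) x).hasFDerivAt
  have hu2 : HasFDerivAt (fderiv ℝ u) (fderiv ℝ (fderiv ℝ u) x) x :=
    ((hu.fderiv_right (m := ∞) (by simp)).differentiable (by simp) x).hasFDerivAt
  have hd : ∀ a b : X, fderiv ℝ (fun y => B (u y) (fderiv ℝ u y a)) x b
      = B (u x) (fderiv ℝ (fderiv ℝ u) x b a) + B (fderiv ℝ u x b) (fderiv ℝ u x a) := by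
    intro a b
    have h := (B.hasFDerivAt.comp x hu1).clm_apply (hu2.clm_apply (hasFDerivAt_const a x))
    have h' := congrArg (· b) h.fderiv
    simp only [Function.comp_apply] at h'
    rw [h']
    simp
  have hs : fderiv ℝ (fderiv ℝ u) x v w = fderiv ℝ (fderiv ℝ u) x w v :=
    (hu.contDiffAt.isSymmSndFDerivAt (by rw [minSmoothness_of_isRCLikeNormedField]; exact WithTop.coe_le_coe.2 (le_top : (2 : ℕ∞) ≤ ⊤))) v w
  rw [extDeriv_apply ((contDiff_bilinForm B hu).differentiable (by simp) x), Fin.sum_univ_two]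
  simp only [bilinForm_apply]
  have r0 : (Fin.removeNth (0 : Fin 2) ![v, w]) 0 = w := rfl
  have r1 : (Fin.removeNth (1 : Fin 2) ![v, w]) 0 = v := rfl
  rw [r0, r1, hd, hd]
  simp only [Fin.val_zero, Fin.val_one, Matrix.cons_val_zero, Matrix.cons_val_one, pow_zero, pow_one,
    one_smul, hs, hB (fderiv ℝ u x w)]
  simp
  ring

end Forms

/-! ### The two forms on `H^{1/2}_0(S¹, N)`. -/

section HalfForms

variable {E : Type*} [NormedAddCommGroup E] [NormedSpace ℝ E]
  {N : Type*} [TopologicalSpace N] [ChartedSpace E N]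
  {V : Type*} [NormedAddCommGroup V] [InnerProductSpace ℂ V] [FiniteDimensional ℂ V]
  (ι : N → V) (hι : ContMDiff 𝓘(ℝ, E) 𝓘(ℝ, V) ∞ ι) (x₀ : N)

variable {ι hι x₀} in
lemma isPlot_halfLoopSpace_iff {n : ℕ} {p : EuclideanSpace ℝ (Fin n) → HalfLoopSpace ι hι x₀} :
    Diffeology.IsPlot p ↔ ContDiff ℝ ∞ fun x => (p x : Sobolev (1 / 2) V) :=
  have := FiniteDimensional.complete ℂ V
  let _ := InnerProductSpace.rclikeToReal ℂ (Sobolev (1 / 2) V)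
  isPlot_reflexiveCompletion_iff

variable {ι hι x₀} in
lemma SameTangent.fderiv_halfLoopSpace_eq {n m : ℕ}
    {p : EuclideanSpace ℝ (Fin n) → HalfLoopSpace ι hι x₀}
    {q : EuclideanSpace ℝ (Fin m) → HalfLoopSpace ι hι x₀}
    {y Y : EuclideanSpace ℝ (Fin n)} {z Z : EuclideanSpace ℝ (Fin m)}
    (h : SameTangent p q y Y z Z) (hp : Diffeology.IsPlot p) (hq : Diffeology.IsPlot q) :
    fderiv ℝ (fun x => (p x : Sobolev (1 / 2) V)) y Y
      = fderiv ℝ (fun x => (q x : Sobolev (1 / 2) V)) z Z :=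
  have := FiniteDimensional.complete ℂ V
  let _ := InnerProductSpace.rclikeToReal ℂ (Sobolev (1 / 2) V)
  fderiv_coe_eq_of_sameTangent (isPlot_halfLoopSpace_iff.1 hp) (isPlot_halfLoopSpace_iff.1 hq) h

/-- The `1`-form `X ↦ ⟨u', X⟩` of `H^{1/2}_0(S¹, N)`. -/
noncomputable def halfTheta : DForm 1 (HalfLoopSpace ι hι x₀) where
  onPlot p _ := bilinForm (derivPairing V) fun x => (p x : Sobolev (1 / 2) V)
  smooth _ hp := contDiff_bilinForm _ (isPlot_halfLoopSpace_iff.1 hp)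
  compat p q hp hq y z Y Z h h0 := by
    rw [bilinForm_apply, bilinForm_apply, h0, (h 0).fderiv_halfLoopSpace_eq hp hq]

lemma half_extDeriv_halfTheta_apply {n : ℕ} {p : EuclideanSpace ℝ (Fin n) → HalfLoopSpace ι hι x₀}
    (hp : Diffeology.IsPlot p) (x v w : EuclideanSpace ℝ (Fin n)) :
    ((1 / 2 : ℝ) • extDeriv ((halfTheta ι hι x₀).onPlot p hp) x) ![v, w]
      = pairing (derivHalf (fderiv ℝ (fun y => (p y : Sobolev (1 / 2) V)) x v))
        (fderiv ℝ (fun y => (p y : Sobolev (1 / 2) V)) x w) := by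
  have h := extDeriv_bilinForm_apply (B := derivPairing V) derivPairing_skew
    (isPlot_halfLoopSpace_iff.1 hp) x v w
  change (1 / 2 : ℝ) * extDeriv (bilinForm (derivPairing V) _) x ![v, w] = _
  rw [h, ← derivPairing_apply]
  ring

/-- The `2`-form `(X, Y) ↦ ⟨X', Y⟩` of `H^{1/2}_0(S¹, N)`. -/
noncomputable def halfOmega : DForm 2 (HalfLoopSpace ι hι x₀) where
  -- With this choice `Ω = dθ` holds by definition, and smoothness is inherited; the pairing formula
  -- is needed for compatibility.
  onPlot p hp x := (1 / 2 : ℝ) • extDeriv ((halfTheta ι hι x₀).onPlot p hp) x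
  smooth p hp := (contDiff_extDeriv ((halfTheta ι hι x₀).smooth p hp)).const_smul (1 / 2 : ℝ)
  compat p q hp hq y z Y Z h h0 := by
    have e : ∀ {m : ℕ} (Y : Fin 2 → EuclideanSpace ℝ (Fin m)), Y = ![Y 0, Y 1] := fun Y => by
      ext i; fin_cases i <;> rfl
    rw [e Y, e Z, half_extDeriv_halfTheta_apply, half_extDeriv_halfTheta_apply]
    rw [(h 0).fderiv_halfLoopSpace_eq hp hq, (h 1).fderiv_halfLoopSpace_eq hp hq]

end HalfForms

section ReInner

variable (V : Type*) [NormedAddCommGroup V] [InnerProductSpace ℂ V]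

/-- The Euclidean product `(u, v) = Re ⟨u, v⟩`. -/
noncomputable def reInner : V →L[ℝ] V →L[ℝ] ℝ :=
  let _ := InnerProductSpace.rclikeToReal ℂ V
  innerSL ℝ

variable {V}

lemma reInner_apply (u v : V) : reInner V u v = (inner ℂ u v).re := rfl

lemma reInner_comm (u v : V) : reInner V u v = reInner V v u :=
  inner_re_symm (𝕜 := ℂ) u v

lemma reInner_self (u : V) : reInner V u u = ‖u‖ ^ 2 := by
  rw [reInner_apply, inner_self_eq_norm_sq_to_K]
  norm_cast

end ReInner

/-! ### Maps out of `N` read in charts. -/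

section Charts

variable {E : Type*} [NormedAddCommGroup E] [NormedSpace ℝ E]
  {N : Type*} [TopologicalSpace N] [ChartedSpace E N] [IsManifold 𝓘(ℝ, E) ∞ N]
  {V : Type*} [NormedAddCommGroup V] [NormedSpace ℝ V]

/-- A map `ι : N → V`, read in the preferred chart at `q`. -/
noncomputable def chartRep (E : Type*) [NormedAddCommGroup E] [NormedSpace ℝ E]
    {N : Type*} [TopologicalSpace N] [ChartedSpace E N] {V : Type*} (ι : N → V) (q : N) : E → V :=
  ι ∘ (extChartAt 𝓘(ℝ, E) q).symm

variable {ι : N → V} (hι : ContMDiff 𝓘(ℝ, E) 𝓘(ℝ, V) ∞ ι) {q : N}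

lemma mdifferentiableAt_extChartAt_symm_of_mem {y : E} (hy : y ∈ (extChartAt 𝓘(ℝ, E) q).target) :
    MDifferentiableAt 𝓘(ℝ, E) 𝓘(ℝ, E) (extChartAt 𝓘(ℝ, E) q).symm y :=
  have : IsManifold 𝓘(ℝ, E) 1 N := IsManifold.of_le (n := ∞) (by simp)
  (mdifferentiableOn_extChartAt_symm y hy).mdifferentiableAt
    ((isOpen_extChartAt_target q).mem_nhds hy)

include hι in
lemma contDiffAt_chartRep {y : E} (hy : y ∈ (extChartAt 𝓘(ℝ, E) q).target) :
    ContDiffAt ℝ ∞ (chartRep E ι q) y := by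
  rw [← contMDiffAt_iff_contDiffAt]
  exact hι.contMDiffAt.comp y ((contMDiffOn_extChartAt_symm q).contMDiffAt
    ((isOpen_extChartAt_target q).mem_nhds hy))

include hι in
lemma fderiv_chartRep {y : E} (hy : y ∈ (extChartAt 𝓘(ℝ, E) q).target) (a : E) :
    fderiv ℝ (chartRep E ι q) y a
      = mfderiv 𝓘(ℝ, E) 𝓘(ℝ, V) ι ((extChartAt 𝓘(ℝ, E) q).symm y)
        (mfderiv 𝓘(ℝ, E) 𝓘(ℝ, E) (extChartAt 𝓘(ℝ, E) q).symm y a) := by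
  rw [← mfderiv_eq_fderiv, chartRep, mfderiv_comp y (hι.mdifferentiableAt (by simp))
    (mdifferentiableAt_extChartAt_symm_of_mem hy)]
  rfl

include hι in
lemma mfderiv_eq_fderiv_chartRep {p : N} (hp : p ∈ (extChartAt 𝓘(ℝ, E) q).source)
    (v : TangentSpace 𝓘(ℝ, E) p) :
    mfderiv 𝓘(ℝ, E) 𝓘(ℝ, V) ι p v = fderiv ℝ (chartRep E ι q) (extChartAt 𝓘(ℝ, E) q p)
      (mfderiv 𝓘(ℝ, E) 𝓘(ℝ, E) (extChartAt 𝓘(ℝ, E) q) p v) := by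
  have : IsManifold 𝓘(ℝ, E) 1 N := IsManifold.of_le (n := ∞) (by simp)
  have he : ι =ᶠ[𝓝 p] chartRep E ι q ∘ extChartAt 𝓘(ℝ, E) q := by
    filter_upwards [(isOpen_extChartAt_source q).mem_nhds hp] with z hz
    simp only [chartRep, Function.comp_apply, PartialEquiv.left_inv _ hz]
  have hd := ((contDiffAt_chartRep hι ((extChartAt 𝓘(ℝ, E) q).map_source hp)).differentiableAt
    (by simp)).mdifferentiableAt
  have h := mfderiv_comp p hd (mdifferentiableAt_extChartAt (by rwa [extChartAt_source] at hp))
  rw [he.mfderiv_eq, h, mfderiv_eq_fderiv]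
  rfl

end Charts

/-! ### Christoffel symbols of an embedded manifold. -/

section LeviCivita

variable {E : Type*} [NormedAddCommGroup E] [NormedSpace ℝ E]
  {N : Type*} [TopologicalSpace N] [ChartedSpace E N] [IsManifold 𝓘(ℝ, E) ∞ N]
  {g : Bundle.ContMDiffRiemannianMetric 𝓘(ℝ, E) ∞ E (fun x : N => TangentSpace 𝓘(ℝ, E) x)}
  {V : Type*} [NormedAddCommGroup V] [InnerProductSpace ℂ V]
  {ι : N → V} (hι : IsRiemannianEmbedding g ι) {q : N}

include hι

lemma chartMetric_eq {y : E} (hy : y ∈ (extChartAt 𝓘(ℝ, E) q).target) (a b : E) :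
    chartMetric g q y a b
      = reInner V (fderiv ℝ (chartRep E ι q) y a) (fderiv ℝ (chartRep E ι q) y b) := by
  rw [fderiv_chartRep hι.isSmoothEmbedding.contMDiff hy,
    fderiv_chartRep hι.isSmoothEmbedding.contMDiff hy]
  exact (hι.isometric _ _ _).symm

omit [NormedAddCommGroup V] [InnerProductSpace ℂ V] hι in
lemma chartMetric_self_pos {y : E} (hy : y ∈ (extChartAt 𝓘(ℝ, E) q).target) {a : E} (ha : a ≠ 0) :
    0 < chartMetric g q y a a := by
  have : IsManifold 𝓘(ℝ, E) 1 N := IsManifold.of_le (n := ∞) (by simp)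
  refine g.pos _ _ fun h0 => ha ?_
  -- The derivative of the chart is a left inverse of that of the inverse chart, so the latter is
  -- injective.
  have h := mfderiv_extChartAt_comp_mfderivWithin_extChartAt_symm hy
  rw [ModelWithCorners.range_eq_univ, mfderivWithin_univ] at h
  let L := mfderiv 𝓘(ℝ, E) 𝓘(ℝ, E) (extChartAt 𝓘(ℝ, E) q) ((extChartAt 𝓘(ℝ, E) q).symm y)
  exact (DFunLike.congr_fun h a).symm.trans ((congrArg L h0).trans (map_zero L))

/-- With `f` the embedding in the chart, the metric is `(Df a, Df b)`. Differentiating it three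
times over gives six terms; by symmetry of `D²f` four cancel and two agree. -/
lemma christoffelLower_eq {y : E} (hy : y ∈ (extChartAt 𝓘(ℝ, E) q).target) (a b c : E) :
    christoffelLower g q y a b c
      = reInner V (fderiv ℝ (fderiv ℝ (chartRep E ι q)) y a b)
        (fderiv ℝ (chartRep E ι q) y c) := by
  set f := chartRep E ι q with hf
  have hcd : ContDiffAt ℝ ∞ f y := contDiffAt_chartRep hι.isSmoothEmbedding.contMDiff hy
  have h2 : HasFDerivAt (fderiv ℝ f) (fderiv ℝ (fderiv ℝ f) y) y :=
    ((hcd.fderiv_right (m := ∞) (by simp)).differentiableAt (by simp)).hasFDerivAt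
  have hs : ∀ v w, fderiv ℝ (fderiv ℝ f) y v w = fderiv ℝ (fderiv ℝ f) y w v :=
    hcd.isSymmSndFDerivAt (by
      rw [minSmoothness_of_isRCLikeNormedField]; exact WithTop.coe_le_coe.2 (le_top : (2 : ℕ∞) ≤ ⊤))
  have hd : ∀ u v w : E, fderiv ℝ (fun z => chartMetric g q z u v) y w
      = reInner V (fderiv ℝ f y u) (fderiv ℝ (fderiv ℝ f) y w v)
        + reInner V (fderiv ℝ (fderiv ℝ f) y w u) (fderiv ℝ f y v) := by
    intro u v w
    have he : (fun z => chartMetric g q z u v) =ᶠ[𝓝 y]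
        fun z => reInner V (fderiv ℝ f z u) (fderiv ℝ f z v) := by
      filter_upwards [(isOpen_extChartAt_target q).mem_nhds hy] with z hz
      exact chartMetric_eq hι hz u v
    have h := ((reInner V).hasFDerivAt.comp y (h2.clm_apply (hasFDerivAt_const u y))).clm_apply
      (h2.clm_apply (hasFDerivAt_const v y))
    have h' := congrArg (· w) h.fderiv
    simp only [Function.comp_apply] at h'
    rw [he.fderiv_eq, h']
    simp
  rw [christoffelLower, hd, hd, hd, hs b a, hs c a, hs c b,
    reInner_comm (fderiv ℝ f y b) , reInner_comm (fderiv ℝ f y a)]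
  ring

variable [FiniteDimensional ℝ E]

/-- The choice defining `christoffel` is meaningful only if a solution exists: the metric is
positive definite, hence injective into the dual, hence onto it since `E` is finite-dimensional. -/
lemma chartMetric_christoffel {y : E} (hy : y ∈ (extChartAt 𝓘(ℝ, E) q).target) (a b c : E) :
    chartMetric g q y (christoffel g q y a b) c = christoffelLower g q y a b c := by
  let f := chartRep E ι q
  let L : E →ₗ[ℝ] E →ₗ[ℝ] ℝ := LinearMap.mk₂ ℝ
    (fun u v => reInner V (fderiv ℝ f y u) (fderiv ℝ f y v)) (by simp) (by simp) (by simp) (by simp)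
  have hL : Function.Injective L := by
    rw [← LinearMap.ker_eq_bot, LinearMap.ker_eq_bot']
    intro u hu
    by_contra hu0
    have h1 := chartMetric_self_pos (g := g) hy hu0
    have h2 : L u u = 0 := by rw [hu]; rfl
    rw [chartMetric_eq hι hy] at h1
    exact h1.ne' h2
  have hL' : Function.Surjective L :=
    (LinearMap.injective_iff_surjective_of_finrank_eq_finrank
      (Subspace.dual_finrank_eq (K := ℝ) (V := E)).symm).1 hL
  obtain ⟨w, hw⟩ := hL' ((reInner V (fderiv ℝ (fderiv ℝ f) y a b)).toLinearMap ∘ₗ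
    (fderiv ℝ f y).toLinearMap)
  refine Classical.epsilon_spec (p := fun w => ∀ c, chartMetric g q y w c
    = christoffelLower g q y a b c) ⟨w, fun c => ?_⟩ c
  rw [chartMetric_eq hι hy, christoffelLower_eq hι hy]
  exact congrArg (fun l => l c) hw

/-- Gauss formula: `Df Γ(a, b)` is the tangential part of `D²f(a, b)`. -/
lemma reInner_fderiv_christoffel {y : E} (hy : y ∈ (extChartAt 𝓘(ℝ, E) q).target) (a b c : E) :
    reInner V (fderiv ℝ (chartRep E ι q) y (christoffel g q y a b)) (fderiv ℝ (chartRep E ι q) y c)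
      = reInner V (fderiv ℝ (fderiv ℝ (chartRep E ι q)) y a b)
        (fderiv ℝ (chartRep E ι q) y c) := by
  rw [← chartMetric_eq hι hy, chartMetric_christoffel hι hy, christoffelLower_eq hι hy]

end LeviCivita

/-! ### Vector fields along curves and their push-forward to `V`. -/

section AlongCurves

variable {E : Type*} [NormedAddCommGroup E] [NormedSpace ℝ E]
  {N : Type*} [TopologicalSpace N] [ChartedSpace E N] [IsManifold 𝓘(ℝ, E) ∞ N]
  {V : Type*} [NormedAddCommGroup V] [NormedSpace ℝ V]

/-- The push-forward by `ι : N → V` of a vector field along a curve in `N`. -/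
noncomputable def pushField (ι : N → V) (γ : ℝ → N) (X : ∀ t : ℝ, TangentSpace 𝓘(ℝ, E) (γ t))
    (t : ℝ) : V :=
  mfderiv 𝓘(ℝ, E) 𝓘(ℝ, V) ι (γ t) (X t)

variable {γ : ℝ → N} {X : ∀ t : ℝ, TangentSpace 𝓘(ℝ, E) (γ t)}

lemma contMDiff_base_of_field (hX : ContMDiff 𝓘(ℝ, ℝ) 𝓘(ℝ, E).tangent ∞
    (fun s => (⟨γ s, X s⟩ : TangentBundle 𝓘(ℝ, E) N))) : ContMDiff 𝓘(ℝ, ℝ) 𝓘(ℝ, E) ∞ γ :=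
  (Bundle.contMDiff_proj (TangentSpace 𝓘(ℝ, E))).comp hX

omit [IsManifold 𝓘(ℝ, E) ∞ N] in
lemma contDiffAt_chart_curve (hγ : ContMDiff 𝓘(ℝ, ℝ) 𝓘(ℝ, E) ∞ γ) (s : ℝ) :
    ContDiffAt ℝ ∞ (fun t => extChartAt 𝓘(ℝ, E) (γ s) (γ t)) s := by
  rw [← contMDiffAt_iff_contDiffAt]
  exact (contMDiffAt_extChartAt (x := γ s)).comp s hγ.contMDiffAt

omit [IsManifold 𝓘(ℝ, E) ∞ N] in
lemma eventually_mem_chart_source (hγ : ContMDiff 𝓘(ℝ, ℝ) 𝓘(ℝ, E) ∞ γ) (s : ℝ) :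
    ∀ᶠ t in 𝓝 s, γ t ∈ (extChartAt 𝓘(ℝ, E) (γ s)).source :=
  hγ.continuous.continuousAt.eventually (extChartAt_source_mem_nhds (I := 𝓘(ℝ, E)) (γ s))

/-- Smoothness of a vector field along a curve, in terms of its chart representative. -/
lemma contMDiffAt_field_iff {s : ℝ} (hγ : ContMDiff 𝓘(ℝ, ℝ) 𝓘(ℝ, E) ∞ γ) :
    ContMDiffAt 𝓘(ℝ, ℝ) 𝓘(ℝ, E).tangent ∞ (fun t => (⟨γ t, X t⟩ : TangentBundle 𝓘(ℝ, E) N)) s ↔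
      ContDiffAt ℝ ∞ (fun t =>
        (mfderiv 𝓘(ℝ, E) 𝓘(ℝ, E) (extChartAt 𝓘(ℝ, E) (γ s)) (γ t) (X t) : E)) s := by
  have : IsManifold 𝓘(ℝ, E) 1 N := IsManifold.of_le (n := ∞) (by simp)
  rw [Bundle.contMDiffAt_totalSpace, and_iff_right hγ.contMDiffAt, contMDiffAt_iff_contDiffAt]
  -- Over the chart domain, the trivialization of the tangent bundle is the derivative of the chart.
  suffices he : (fun t => ((trivializationAt E (TangentSpace 𝓘(ℝ, E)) (γ s))
      (⟨γ t, X t⟩ : TangentBundle 𝓘(ℝ, E) N)).2) =ᶠ[𝓝 s] fun t =>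
        (mfderiv 𝓘(ℝ, E) 𝓘(ℝ, E) (extChartAt 𝓘(ℝ, E) (γ s)) (γ t) (X t) : E) from
    ⟨fun h => h.congr_of_eventuallyEq he.symm, fun h => h.congr_of_eventuallyEq he⟩
  filter_upwards [eventually_mem_chart_source hγ s] with t ht
  rw [extChartAt_source] at ht
  have h1 := TangentBundle.continuousLinearMapAt_trivializationAt (I := 𝓘(ℝ, E)) ht
  have h2 := DFunLike.congr_fun h1 (X t)
  refine Eq.trans ?_ h2
  rw [Bundle.Trivialization.continuousLinearMapAt_apply, Bundle.Trivialization.linearMapAt_apply,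
    if_pos (by simpa using ht)]

variable {ι : N → V} (hι : ContMDiff 𝓘(ℝ, E) 𝓘(ℝ, V) ∞ ι)
  (hX : ContMDiff 𝓘(ℝ, ℝ) 𝓘(ℝ, E).tangent ∞ (fun s => (⟨γ s, X s⟩ : TangentBundle 𝓘(ℝ, E) N)))

include hι in
lemma pushField_eventuallyEq (hγ : ContMDiff 𝓘(ℝ, ℝ) 𝓘(ℝ, E) ∞ γ) (s : ℝ) :
    pushField ι γ X =ᶠ[𝓝 s] fun t => fderiv ℝ (chartRep E ι (γ s))
      (extChartAt 𝓘(ℝ, E) (γ s) (γ t))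
      (mfderiv 𝓘(ℝ, E) 𝓘(ℝ, E) (extChartAt 𝓘(ℝ, E) (γ s)) (γ t) (X t)) := by
  filter_upwards [eventually_mem_chart_source hγ s] with t ht
  exact mfderiv_eq_fderiv_chartRep hι ht (X t)

include hι hX in
lemma contDiff_pushField : ContDiff ℝ ∞ (pushField ι γ X) := by
  have hγ := contMDiff_base_of_field hX
  refine contDiff_iff_contDiffAt.2 fun s => ?_
  refine ContDiffAt.congr_of_eventuallyEq ?_ (pushField_eventuallyEq hι hγ s)
  have h1 : ContDiffAt ℝ ∞ (fderiv ℝ (chartRep E ι (γ s))) (extChartAt 𝓘(ℝ, E) (γ s) (γ s)) :=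
    (contDiffAt_chartRep hι (mem_extChartAt_target (γ s))).fderiv_right (by simp)
  exact (h1.comp s (contDiffAt_chart_curve hγ s)).clm_apply ((contMDiffAt_field_iff hγ).1 (hX s))

omit [IsManifold 𝓘(ℝ, E) ∞ N] in
lemma periodic_pushField (hp : Function.Periodic
    (fun s => (⟨γ s, X s⟩ : TangentBundle 𝓘(ℝ, E) N)) 1) : Function.Periodic (pushField ι γ X) 1 :=
  fun s => congrArg (fun z : TangentBundle 𝓘(ℝ, E) N =>
    (mfderiv 𝓘(ℝ, E) 𝓘(ℝ, V) ι z.1 z.2 : V)) (hp s)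

end AlongCurves

/-! ### The covariant derivative as a tangential projection. -/

section LeviCivita

variable {E : Type*} [NormedAddCommGroup E] [NormedSpace ℝ E] [FiniteDimensional ℝ E]
  {N : Type*} [TopologicalSpace N] [ChartedSpace E N] [IsManifold 𝓘(ℝ, E) ∞ N]
  {g : Bundle.ContMDiffRiemannianMetric 𝓘(ℝ, E) ∞ E (fun x : N => TangentSpace 𝓘(ℝ, E) x)}
  {V : Type*} [NormedAddCommGroup V] [InnerProductSpace ℂ V]
  {ι : N → V} (hι : IsRiemannianEmbedding g ι)
  {γ : ℝ → N} {X : ∀ t : ℝ, TangentSpace 𝓘(ℝ, E) (γ t)}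
  (hX : ContMDiff 𝓘(ℝ, ℝ) 𝓘(ℝ, E).tangent ∞ (fun s => (⟨γ s, X s⟩ : TangentBundle 𝓘(ℝ, E) N)))

include hι hX

/-- The Levi-Civita covariant derivative is the tangential part of the derivative in the ambient
space. -/
theorem inner_covDeriv (Y : ∀ t : ℝ, TangentSpace 𝓘(ℝ, E) (γ t)) (s : ℝ) :
    g.inner (γ s) (covDeriv g γ X s) (Y s)
      = reInner V (deriv (pushField ι γ X) s) (pushField ι γ Y s) := by
  have : IsManifold 𝓘(ℝ, E) 1 N := IsManifold.of_le (n := ∞) (by simp)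
  have hγ := contMDiff_base_of_field hX
  have hsm := hι.isSmoothEmbedding.contMDiff
  let φ := extChartAt 𝓘(ℝ, E) (γ s)
  let f := chartRep E ι (γ s)
  let c : ℝ → E := fun t => φ (γ t)
  let W : ℝ → E := fun t => mfderiv 𝓘(ℝ, E) 𝓘(ℝ, E) φ (γ t) (X t)
  let Γ : E := christoffel g (γ s) (c s) (deriv c s) (W s)
  let D := mfderiv 𝓘(ℝ, E) 𝓘(ℝ, E) φ (γ s)
  have hy : c s ∈ φ.target := mem_extChartAt_target (γ s)
  have hc : HasDerivAt c (deriv c s) s :=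
    ((contDiffAt_chart_curve hγ s).differentiableAt (by simp)).hasDerivAt
  have hW : HasDerivAt W (deriv W s) s :=
    (((contMDiffAt_field_iff hγ).1 (hX s)).differentiableAt (by simp)).hasDerivAt
  have hf : HasFDerivAt (fderiv ℝ f) (fderiv ℝ (fderiv ℝ f) (c s)) (c s) :=
    (((contDiffAt_chartRep hsm hy).fderiv_right (m := ∞) (by simp)).differentiableAt
      (by simp)).hasFDerivAt
  -- Near `s` the pushed field is `Df(c) W`; by the product rule its derivative has a second-order
  -- term, whose tangential part is the Christoffel term.
  have hZ : deriv (pushField ι γ X) s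
      = fderiv ℝ (fderiv ℝ f) (c s) (deriv c s) (W s) + fderiv ℝ f (c s) (deriv W s) := by
    rw [(pushField_eventuallyEq hsm hγ s).deriv_eq]
    exact ((hf.comp_hasDerivAt s hc).clm_apply hW).deriv
  have hcov : D (covDeriv g γ X s) = deriv W s + Γ :=
    (isInvertible_mfderiv_extChartAt (I := 𝓘(ℝ, E)) (mem_extChartAt_source (γ s))
      ).self_apply_inverse (deriv W s + Γ)
  have hpush : ∀ v : TangentSpace 𝓘(ℝ, E) (γ s),
      (mfderiv 𝓘(ℝ, E) 𝓘(ℝ, V) ι (γ s) v : V) = fderiv ℝ f (c s) (D v) := fun v =>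
    mfderiv_eq_fderiv_chartRep hsm (mem_extChartAt_source (γ s)) v
  have hΓ := reInner_fderiv_christoffel hι hy (deriv c s) (W s) (D (Y s))
  have hmain : g.inner (γ s) (covDeriv g γ X s) (Y s)
      = reInner V (fderiv ℝ f (c s) (D (covDeriv g γ X s))) (fderiv ℝ f (c s) (D (Y s))) := by
    rw [← hpush, ← hpush]
    exact (hι.isometric _ _ _).symm
  have hYs : pushField ι γ Y s = fderiv ℝ f (c s) (D (Y s)) := hpush (Y s)
  rw [hmain, hcov, hZ, hYs, map_add, map_add, map_add, add_apply, add_apply, add_comm]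
  exact congrArg (· + _) hΓ

theorem omegaN_eq (Y : ∀ t : ℝ, TangentSpace 𝓘(ℝ, E) (γ t)) :
    omegaN g γ X Y
      = ∫ s in (0 : ℝ)..1, reInner V (deriv (pushField ι γ X) s) (pushField ι γ Y s) :=
  intervalIntegral.integral_congr fun s _ => inner_covDeriv hι hX Y s

end LeviCivita

/-! ### Plots of the based loop space and their velocities. -/

section LoopFamilies

variable {E : Type*} [NormedAddCommGroup E] [NormedSpace ℝ E]
  {N : Type*} [TopologicalSpace N] [ChartedSpace E N]
  {V : Type*} [NormedAddCommGroup V] [InnerProductSpace ℂ V]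
  {x₀ : N} {n : ℕ} {P : EuclideanSpace ℝ (Fin n) → BasedLoop E x₀}

lemma contMDiff_of_isPlot_basedLoop (hP : Diffeology.IsPlot P) :
    ContMDiff (𝓘(ℝ, EuclideanSpace ℝ (Fin n)).prod 𝓘(ℝ, ℝ)) 𝓘(ℝ, E) ∞
      (fun z : EuclideanSpace ℝ (Fin n) × ℝ => (P z.1).toFun z.2) := by
  rw [← contMDiffOn_univ, ← Set.univ_prod_univ]
  exact hP

lemma contMDiff_plot_left (hP : Diffeology.IsPlot P) (s : ℝ) :
    ContMDiff 𝓘(ℝ, EuclideanSpace ℝ (Fin n)) 𝓘(ℝ, E) ∞ fun y => (P y).toFun s :=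
  (contMDiff_of_isPlot_basedLoop hP).comp (contMDiff_id.prodMk contMDiff_const)

variable {ι : N → V} (hι : ContMDiff 𝓘(ℝ, E) 𝓘(ℝ, V) ∞ ι)

include hι in
lemma contDiff_family (hP : Diffeology.IsPlot P) : ContDiff ℝ ∞
    fun z : EuclideanSpace ℝ (Fin n) × ℝ => ι ((P z.1).toFun z.2) := by
  have h := hι.comp (contMDiff_of_isPlot_basedLoop hP)
  rw [← contMDiff_iff_contDiff, modelWithCornersSelf_prod, ← chartedSpaceSelf_prod]
  exact h

include hι in
lemma pushField_velocity (hP : Diffeology.IsPlot P) (x v : EuclideanSpace ℝ (Fin n)) :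
    pushField ι (P x).toFun (velocity P x v)
      = fun s => fderiv ℝ (fun y => ι ((P y).toFun s)) x v := by
  funext s
  have h := mfderiv_comp x (hι.mdifferentiableAt (by simp))
    ((contMDiff_plot_left hP s).mdifferentiableAt (by simp))
  rw [← mfderiv_eq_fderiv]
  exact (DFunLike.congr_fun h v).symm

include hι in
-- This matches the two notions of tangent vector: the derivative in `H^{1/2}` is the loop obtained
-- by pushing the velocity field into `V`.
lemma fderiv_toSobolev [FiniteDimensional ℂ V] (hP : Diffeology.IsPlot P)
    (x v : EuclideanSpace ℝ (Fin n))
    (hZ : ContDiff ℝ ∞ (pushField ι (P x).toFun (velocity P x v)))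
    (hp : Function.Periodic (pushField ι (P x).toFun (velocity P x v)) 1) :
    fderiv ℝ (fun y => (P y).toSobolev ι hι) x v
      = ofSmoothLoop (pushField ι (P x).toFun (velocity P x v)) hZ hp := by
  have e := pushField_velocity hι hP x v
  simp only [e] at hZ hp ⊢
  exact fderiv_ofSmoothLoop (contDiff_family hι hP) _ _ x v hZ hp

lemma dSmooth_incl [FiniteDimensional ℂ V] :
    Diffeology.DSmooth (BasedLoop.incl (x₀ := x₀) ι hι) := fun _ P hP =>
  isPlot_halfLoopSpace_iff.2 (contDiff_ofSmoothLoop (contDiff_family hι hP)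
    (fun x => contMDiff_iff_contDiff.1 (hι.comp (P x).smooth))
    (fun x => (P x).periodic.comp ι))

lemma periodic_velocity (P : EuclideanSpace ℝ (Fin n) → BasedLoop E x₀)
    (x v : EuclideanSpace ℝ (Fin n)) : Function.Periodic
      (fun s => (⟨(P x).toFun s, velocity P x v s⟩ : TangentBundle 𝓘(ℝ, E) N)) 1 := by
  intro s
  have h : (fun y => (P y).toFun (s + 1)) = fun y => (P y).toFun s :=
    funext fun y => (P y).periodic s
  change (⟨(fun y => (P y).toFun (s + 1)) x, mfderiv 𝓘(ℝ, EuclideanSpace ℝ (Fin n)) 𝓘(ℝ, E)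
    (fun y => (P y).toFun (s + 1)) x v⟩ : TangentBundle 𝓘(ℝ, E) N) = _
  rw [h]
  rfl

/-- In the chart at `P x s` the velocity becomes a partial derivative of a function jointly smooth
in time and parameter. -/
lemma contMDiff_velocity [IsManifold 𝓘(ℝ, E) ∞ N] (hP : Diffeology.IsPlot P)
    (x v : EuclideanSpace ℝ (Fin n)) : ContMDiff 𝓘(ℝ, ℝ) 𝓘(ℝ, E).tangent ∞
      (fun s => (⟨(P x).toFun s, velocity P x v s⟩ : TangentBundle 𝓘(ℝ, E) N)) := by
  have : IsManifold 𝓘(ℝ, E) 1 N := IsManifold.of_le (n := ∞) (by simp)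
  intro s
  rw [contMDiffAt_field_iff (P x).smooth]
  let φ := extChartAt 𝓘(ℝ, E) ((P x).toFun s)
  have h0 : ContMDiff (𝓘(ℝ, ℝ).prod 𝓘(ℝ, EuclideanSpace ℝ (Fin n))) 𝓘(ℝ, E) ∞
      (fun z : ℝ × EuclideanSpace ℝ (Fin n) => (P z.2).toFun z.1) :=
    (contMDiff_of_isPlot_basedLoop hP).comp (contMDiff_snd.prodMk contMDiff_fst)
  have h1 : ContDiffAt ℝ ∞
      (fun z : ℝ × EuclideanSpace ℝ (Fin n) => φ ((P z.2).toFun z.1)) (s, x) := by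
    have h := (contMDiffAt_extChartAt (x := (P x).toFun s)).comp (s, x) (h0 (s, x))
    rw [← contMDiffAt_iff_contDiffAt, modelWithCornersSelf_prod, ← chartedSpaceSelf_prod]
    exact h
  have h2 : ContDiffAt ℝ ∞ (fun t => fderiv ℝ (fun y => φ ((P y).toFun t)) x v) s :=
    (ContDiffAt.fderiv (m := ∞) (n := ∞) (f := fun t y => φ ((P y).toFun t)) (g := fun _ => x)
      h1 contDiffAt_const (by simp)).clm_apply contDiffAt_const
  refine h2.congr_of_eventuallyEq ?_
  filter_upwards [eventually_mem_chart_source (P x).smooth s] with t ht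
  rw [extChartAt_source] at ht
  have h := mfderiv_comp x (mdifferentiableAt_extChartAt (I := 𝓘(ℝ, E)) ht)
    ((contMDiff_plot_left hP t).mdifferentiableAt (by simp))
  rw [← mfderiv_eq_fderiv]
  exact (DFunLike.congr_fun h v).symm

end LoopFamilies

/-! ### Restriction of the pairings to smooth loops. -/

section Restriction

variable {E : Type*} [NormedAddCommGroup E] [NormedSpace ℝ E] [FiniteDimensional ℝ E]
  {N : Type*} [TopologicalSpace N] [ChartedSpace E N] [IsManifold 𝓘(ℝ, E) ∞ N]
  {V : Type*} [NormedAddCommGroup V] [InnerProductSpace ℂ V] [FiniteDimensional ℂ V]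
  {x₀ : N} {n : ℕ} {P : EuclideanSpace ℝ (Fin n) → BasedLoop E x₀} {ι : N → V}

omit [FiniteDimensional ℝ E] in
lemma pairing_toSobolev_eq_thetaN (hι : ContMDiff 𝓘(ℝ, E) 𝓘(ℝ, V) ∞ ι) (hP : Diffeology.IsPlot P)
    (x v : EuclideanSpace ℝ (Fin n)) :
    pairing (derivHalf ((P x).toSobolev ι hι)) (fderiv ℝ (fun y => (P y).toSobolev ι hι) x v)
      = thetaN ι (P x).toFun (velocity P x v) := by
  rw [fderiv_toSobolev hι hP x v (contDiff_pushField hι (contMDiff_velocity hP x v))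
    (periodic_pushField (periodic_velocity P x v))]
  exact pairing_derivHalf_ofSmoothLoop _ _ _ _

variable {g : Bundle.ContMDiffRiemannianMetric 𝓘(ℝ, E) ∞ E (fun x : N => TangentSpace 𝓘(ℝ, E) x)}

lemma pairing_fderiv_toSobolev_eq_omegaN (hι : IsRiemannianEmbedding g ι)
    (hP : Diffeology.IsPlot P) (x v w : EuclideanSpace ℝ (Fin n)) :
    pairing (derivHalf (fderiv ℝ (fun y => (P y).toSobolev ι hι.isSmoothEmbedding.contMDiff) x v))
        (fderiv ℝ (fun y => (P y).toSobolev ι hι.isSmoothEmbedding.contMDiff) x w)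
      = omegaN g (P x).toFun (velocity P x v) (velocity P x w) := by
  have hsm := hι.isSmoothEmbedding.contMDiff
  rw [fderiv_toSobolev hsm hP x v (contDiff_pushField hsm (contMDiff_velocity hP x v))
    (periodic_pushField (periodic_velocity P x v)),
    fderiv_toSobolev hsm hP x w (contDiff_pushField hsm (contMDiff_velocity hP x w))
    (periodic_pushField (periodic_velocity P x w)), pairing_derivHalf_ofSmoothLoop,
    omegaN_eq hι (contMDiff_velocity hP x v)]
  rfl

end Restriction

/-! ### Skew-symmetry and weak nondegeneracy of `ω_N`. -/

section Symplectic

variable {E : Type*} [NormedAddCommGroup E] [NormedSpace ℝ E] [FiniteDimensional ℝ E]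
  {N : Type*} [TopologicalSpace N] [ChartedSpace E N] [IsManifold 𝓘(ℝ, E) ∞ N]
  {V : Type*} [NormedAddCommGroup V] [InnerProductSpace ℂ V]
  {g : Bundle.ContMDiffRiemannianMetric 𝓘(ℝ, E) ∞ E (fun x : N => TangentSpace 𝓘(ℝ, E) x)}
  {x₀ : N} {ι : N → V} {γ : BasedLoop E x₀}

lemma hasDerivAt_reInner {Z Z' : ℝ → V} (hZ : ContDiff ℝ ∞ Z) (hZ' : ContDiff ℝ ∞ Z') (s : ℝ) :
    HasDerivAt (fun t => reInner V (Z t) (Z' t))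
      (reInner V (deriv Z s) (Z' s) + reInner V (Z s) (deriv Z' s)) s := by
  have h1 := (hZ.differentiable (by simp) s).hasDerivAt
  have h2 := (hZ'.differentiable (by simp) s).hasDerivAt
  exact (((reInner V).hasFDerivAt.comp_hasDerivAt s h1).clm_apply h2)

omit [FiniteDimensional ℝ E] in
lemma pushField_zero (X : γ.Tangent) : pushField ι γ.toFun X.toFun 0 = 0 := by
  rw [pushField, X.base]
  exact map_zero (mfderiv 𝓘(ℝ, E) 𝓘(ℝ, V) ι (γ.toFun 0))

/-- The integral of `d/ds (X, Y)` over the loop is zero, since `X` vanishes at both ends. -/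
theorem omegaN_skew (hι : IsRiemannianEmbedding g ι) (X Y : γ.Tangent) :
    omegaN g γ.toFun X.toFun Y.toFun = - omegaN g γ.toFun Y.toFun X.toFun := by
  have hsm := hι.isSmoothEmbedding.contMDiff
  have hX := contDiff_pushField hsm X.smooth
  have hY := contDiff_pushField hsm Y.smooth
  have hX1 : Continuous (deriv (pushField ι γ.toFun X.toFun)) := hX.continuous_deriv (by simp)
  have hY1 : Continuous (deriv (pushField ι γ.toFun Y.toFun)) := hY.continuous_deriv (by simp)
  have hX0 := hX.continuous
  have hY0 := hY.continuous
  have i1 : IntervalIntegrable (fun s => reInner V (deriv (pushField ι γ.toFun X.toFun) s)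
      (pushField ι γ.toFun Y.toFun s)) MeasureTheory.volume 0 1 :=
    Continuous.intervalIntegrable (by fun_prop) _ _
  have i2 : IntervalIntegrable (fun s => reInner V (pushField ι γ.toFun X.toFun s)
      (deriv (pushField ι γ.toFun Y.toFun) s)) MeasureTheory.volume 0 1 :=
    Continuous.intervalIntegrable (by fun_prop) _ _
  have h := intervalIntegral.integral_eq_sub_of_hasDerivAt
    (fun s _ => hasDerivAt_reInner hX hY s) (i1.add i2)
  have hp : pushField ι γ.toFun X.toFun 1 = pushField ι γ.toFun X.toFun 0 := by
    simpa using periodic_pushField (ι := ι) X.periodic 0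
  rw [hp, pushField_zero, map_zero, zero_apply, zero_apply, sub_self,
    intervalIntegral.integral_add i1 i2] at h
  rw [omegaN_eq hι X.smooth, omegaN_eq hι Y.smooth]
  simp only [reInner_comm (deriv (pushField ι γ.toFun Y.toFun) _)]
  linarith

/-- The product of a tangent vector of the loop space with a periodic function. -/
noncomputable def BasedLoop.Tangent.smulPeriodic (X : γ.Tangent) (h : ℝ → ℝ) (hh : ContDiff ℝ ∞ h)
    (hp : Function.Periodic h 1) : γ.Tangent where
  toFun s := h s • X.toFun s
  smooth s := by
    rw [contMDiffAt_field_iff γ.smooth]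
    refine (hh.contDiffAt.smul ((contMDiffAt_field_iff γ.smooth).1
      (X.smooth s))).congr_of_eventuallyEq (Filter.Eventually.of_forall fun t => ?_)
    exact map_smul (mfderiv 𝓘(ℝ, E) 𝓘(ℝ, E) (extChartAt 𝓘(ℝ, E) (γ.toFun s)) (γ.toFun t))
      (h t) (X.toFun t)
  periodic s := by
    let F : ℝ → TangentBundle 𝓘(ℝ, E) N → TangentBundle 𝓘(ℝ, E) N := fun c z => ⟨z.1, c • z.2⟩
    change F (h (s + 1)) ⟨γ.toFun (s + 1), X.toFun (s + 1)⟩ = F (h s) ⟨γ.toFun s, X.toFun s⟩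
    rw [hp s]
    exact congrArg (F (h s)) (X.periodic s)
  base := by rw [X.base, smul_zero]

theorem eq_zero_of_omegaN_eq_zero (hι : IsRiemannianEmbedding g ι) (X : γ.Tangent)
    (hX0 : ∀ Y : γ.Tangent, omegaN g γ.toFun X.toFun Y.toFun = 0) (s : ℝ) : X.toFun s = 0 := by
  have hsm := hι.isSmoothEmbedding.contMDiff
  set Z := pushField ι γ.toFun X.toFun with hZdef
  have hZ : ContDiff ℝ ∞ Z := contDiff_pushField hsm X.smooth
  have hZ1 : ContDiff ℝ ∞ (deriv Z) := ContDiff.deriv' (by simpa using hZ)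
  have hZp : Function.Periodic Z 1 := periodic_pushField X.periodic
  -- Half the derivative of `|X|²`. The test field `hX` is tangent to `N` and vanishes at the base
  -- point because `X` does, so it is admissible, and `ω_N(X, hX) = ∫ h²`.
  let h : ℝ → ℝ := fun t => reInner V (deriv Z t) (Z t)
  have hh : ContDiff ℝ ∞ h := ((reInner V).contDiff.comp hZ1).clm_apply hZ
  have hp : Function.Periodic h 1 := fun t => by
    simp only [h, hZp t, periodic_deriv hZp t]
  have hint : ∫ t in (0 : ℝ)..1, h t ^ 2 = 0 := by
    refine Eq.trans ?_ (hX0 (X.smulPeriodic h hh hp))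
    rw [omegaN_eq hι X.smooth]
    refine intervalIntegral.integral_congr fun t _ => ?_
    have e : pushField ι γ.toFun (X.smulPeriodic h hh hp).toFun t = h t • Z t :=
      map_smul (mfderiv 𝓘(ℝ, E) 𝓘(ℝ, V) ι (γ.toFun t)) (h t) (X.toFun t)
    simp only [e, map_smul, smul_eq_mul]
    exact sq (h t)
  have hzero : ∀ t ∈ Set.Icc (0 : ℝ) 1, h t = 0 := by
    by_contra! hne
    obtain ⟨t, ht, hne⟩ := hne
    have := intervalIntegral.integral_pos (zero_lt_one' ℝ) (hh.continuous.pow 2).continuousOn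
      (fun t _ => sq_nonneg (h t)) ⟨t, ht, sq_pos_iff.2 hne⟩
    exact this.ne' hint
  have hconst : ∀ t ∈ Set.Icc (0 : ℝ) 1, reInner V (Z t) (Z t) = reInner V (Z 0) (Z 0) := by
    refine constant_of_has_deriv_right_zero ?_ fun t ht => ?_
    · exact fun t _ => (hasDerivAt_reInner hZ hZ t).continuousAt.continuousWithinAt
    · have := hasDerivAt_reInner hZ hZ t
      rw [reInner_comm (Z t), show reInner V (deriv Z t) (Z t) = 0 from
        hzero t (Set.Ico_subset_Icc_self ht), add_zero] at this
      exact this.hasDerivWithinAt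
  have hZ0 : Z s = 0 := by
    obtain ⟨t, ht, hts⟩ := hZp.exists_mem_Ico₀ one_pos s
    have h1 := hconst t (Set.Ico_subset_Icc_self ht)
    rw [hZdef, pushField_zero, map_zero, ← hZdef, reInner_self] at h1
    rw [hts]
    simpa using h1
  by_contra hne
  have h1 := g.pos (γ.toFun s) (X.toFun s) hne
  rw [← hι.isometric] at h1
  change 0 < reInner V (Z s) (Z s) at h1
  rw [hZ0] at h1
  simp at h1

end Symplectic

end HalfLoop

theorem mainTheorem5
    {E : Type*} [NormedAddCommGroup E] [NormedSpace ℝ E] [FiniteDimensional ℝ E]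
    {N : Type*} [TopologicalSpace N] [ChartedSpace E N] [IsManifold 𝓘(ℝ, E) ∞ N]
    [ConnectedSpace N]
    (g : Bundle.ContMDiffRiemannianMetric 𝓘(ℝ, E) ∞ E (fun x : N => TangentSpace 𝓘(ℝ, E) x))
    {V : Type*} [NormedAddCommGroup V] [InnerProductSpace ℂ V] [FiniteDimensional ℂ V]
    (ι : N → V) (hι : IsRiemannianEmbedding g ι) (x₀ : N) :
    -- the inclusion of `C^∞_0(S¹, N)` into `H^{1/2}_0(S¹, N)` is smooth
    ∃ hj : Diffeology.DSmooth
        (BasedLoop.incl (x₀ := x₀) ι hι.isSmoothEmbedding.contMDiff),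
    ∃ (θ : DForm 1 (HalfLoopSpace ι hι.isSmoothEmbedding.contMDiff x₀))
      (Ω : DForm 2 (HalfLoopSpace ι hι.isSmoothEmbedding.contMDiff x₀)),
      -- `θ` is defined by the duality pairing: `θ_γ(X) = ⟨γ', X⟩`
      (∀ (n : ℕ) (p : EuclideanSpace ℝ (Fin n) → HalfLoopSpace ι hι.isSmoothEmbedding.contMDiff x₀)
        (hp : Diffeology.IsPlot p) (x v : EuclideanSpace ℝ (Fin n)),
        θ.onPlot p hp x ![v] =
          pairing (derivHalf (p x : Sobolev (1 / 2) V))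
            (fderiv ℝ (fun y => (p y : Sobolev (1 / 2) V)) x v)) ∧
      -- `θ` extends the canonical `1`-form of `C^∞_0(S¹, N)`
      (∀ (n : ℕ) (P : EuclideanSpace ℝ (Fin n) → BasedLoop E x₀) (hP : Diffeology.IsPlot P)
        (x v : EuclideanSpace ℝ (Fin n)),
        (θ.pullback _ hj).onPlot P hP x ![v] = thetaN ι (P x).toFun (velocity P x v)) ∧
      -- `Ω = dθ`, on `H^{1/2}_0(S¹, N)` and on `C^∞_0(S¹, N)`
      θ.IsHalfD Ω ∧
      (θ.pullback _ hj).IsHalfD (Ω.pullback _ hj) ∧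
      -- `Ω` is given by the duality pairing: `Ω(X, Y) = ⟨X', Y⟩`
      (∀ (n : ℕ) (p : EuclideanSpace ℝ (Fin n) → HalfLoopSpace ι hι.isSmoothEmbedding.contMDiff x₀)
        (hp : Diffeology.IsPlot p) (x v w : EuclideanSpace ℝ (Fin n)),
        Ω.onPlot p hp x ![v, w] =
          pairing (derivHalf (fderiv ℝ (fun y => (p y : Sobolev (1 / 2) V)) x v))
            (fderiv ℝ (fun y => (p y : Sobolev (1 / 2) V)) x w)) ∧
      -- `Ω` extends the form `ω_N` of `C^∞_0(S¹, N)`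
      (∀ (n : ℕ) (P : EuclideanSpace ℝ (Fin n) → BasedLoop E x₀) (hP : Diffeology.IsPlot P)
        (x v w : EuclideanSpace ℝ (Fin n)),
        (Ω.pullback _ hj).onPlot P hP x ![v, w] =
          omegaN g (P x).toFun (velocity P x v) (velocity P x w)) ∧
      -- `ω_N` is skew-symmetric and weakly nondegenerate on the tangent spaces of `C^∞_0(S¹, N)`
      (∀ (γ : BasedLoop E x₀) (X Y : γ.Tangent),
        omegaN g γ.toFun X.toFun Y.toFun = - omegaN g γ.toFun Y.toFun X.toFun) ∧
      (∀ (γ : BasedLoop E x₀) (X : γ.Tangent),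
        (∀ Y : γ.Tangent, omegaN g γ.toFun X.toFun Y.toFun = 0) → ∀ s, X.toFun s = 0) := by
  refine ⟨dSmooth_incl _, halfTheta ι _ x₀, halfOmega ι _ x₀, fun n p hp x v => rfl,
    fun n P hP x v => pairing_toSobolev_eq_thetaN hι.isSmoothEmbedding.contMDiff hP x v,
    fun _ _ _ => rfl, fun _ _ _ => rfl,
    fun n p hp x v w => half_extDeriv_halfTheta_apply ι _ x₀ hp x v w, fun n P hP x v w => ?_,
    fun γ X Y => omegaN_skew hι X Y, fun γ X hX => eq_zero_of_omegaN_eq_zero hι X hX⟩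
  -- The pulled-back form on `P` is, by definition, the form on the plot obtained by composing `P`
  -- with the inclusion.
  exact (half_extDeriv_halfTheta_apply ι _ x₀ (dSmooth_incl _ n P hP) x v w).trans
    (pairing_fderiv_toSobolev_eq_omegaN hι hP x v w)
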